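/- Let $k$ be an algebraically closed field and let $S$ be a connected compact oriented surface with boundary, with a finite set $M$ of marked points on $\partial S$, and let $T$ be an ideal triangulation of $(S,M)$, that is, a decomposition of $S$ into triangles whose vertices are exactly the marked points and whose sides are arcs (in the interior of $S$ except for their endpoints) and boundary segments. Choose a set $\chi$ of corners of internal triangles of $T$ (triangles none of whose sides is a boundary segment), at most one corner in each internal triangle. Cutting $T$ at $\chi$ means: for each chosen corner, the marked point at that corner is replaced by two marked points joined by a new boundary segment, which separates the two sides of the corner, so that the triangle becomes a quadrilateral. The result is a partial triangulation $P$ of $(S,M')$, with the same arcs, where $M'\subset\partial S$ is the new set of marked points. Assume that $P$ has at least two arcs. The surface algebra of $P$ (in the sense of David-Roesler and Schiffler) is $A=kQ/I$, where the vertices of $Q$ are the arcs of $P$; for each polygon (triangle or quadrilateral) of $P$ there is an arrow $i\to j$ for each pair of consecutive sides of the polygon that are arcs $i$, $j$, with $j$ directly following $i$ counterclockwise; and $I$ is generated by the products $\alpha\beta$ of arrows $\alpha:i\to j$, $\beta:j\to l$ that lie in consecutive corners of the same polygon. Regard $P$ as a (connected) Brauer graph: its edges are the arcs, its vertices are the marked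 points in $M'$ that are endpoints of arcs, the ends of the arcs at each vertex are cyclically ordered clockwise with respect to the orientation of $S$, and every multiplicity is one. Let $B_P$ be the Brauer graph algebra of $P$, that is $B_P=kQ_P/I_P$, where the vertices of $Q_P$ are the edges of $P$; for every end $h$ of an edge at a vertex $v$ of valency at least two there is one arrow $\alpha_h$ from the edge of $h$ to the edge of the successor of $h$ at $v$; and, writing $C_h$ for the cycle that starts with $\alpha_h$ and runs once around $v$, and $\bar h$ for the other end of the edge of $h$, the ideal $I_P$ is generated by (i) $C_h-C_{\bar h}$ if both ends of the edge are at vertices of valency at least two, (ii) $C_h\alpha_h$ if $\bar h$ is at a vertex of valency one, and (iii) $\alpha_h\alpha_{\bar g}$, where $g$ is the successor of $h$, whenever both arrows exist. Then the trivial extension $T(A)=A\ltimes \operatorname{Hom}_k(A,k)$ is isomorphic, as a $k$-algebra, to the Brauer graph algebra $B_P$. -/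

import Mathlib

noncomputable section

/-! ## Path algebras and bound quiver algebras -/

section PathAlgebra

universe u v w

/-- All paths of a quiver: a source, a target, and a path between them. -/
abbrev AllPaths (V : Type u) [Quiver.{v} V] : Type (max u v) :=
  Σ a b : V, Quiver.Path a b

/-- The path algebra `kQ` of a quiver `Q`: the vector space with basis all paths of `Q`. -/
def PathAlgebra (k : Type w) (V : Type u) [Quiver.{v} V] [Field k] : Type (max u v w) :=
  AllPaths V →₀ k

namespace PathAlgebra

variable (k : Type w) {V : Type u} [Quiver.{v} V] [Field k]

instance : AddCommGroup (PathAlgebra k V) := inferInstanceAs (AddCommGroup (AllPaths V →₀ k))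

instance : Module k (PathAlgebra k V) := inferInstanceAs (Module k (AllPaths V →₀ k))

/-- The basis of paths. -/
def basis : Module.Basis (AllPaths V) k (PathAlgebra k V) :=
  ⟨LinearEquiv.refl k (AllPaths V →₀ k)⟩

/-- A path as a basis element of the path algebra. -/
def ofPath {a b : V} (p : Quiver.Path a b) : PathAlgebra k V := basis k ⟨a, b, p⟩

/-- The trivial path `e_a`. -/
def idem (a : V) : PathAlgebra k V := ofPath k (Quiver.Path.nil : Quiver.Path a a)

/-- An arrow as an element of the path algebra. -/
def ofArrow {a b : V} (α : a ⟶ b) : PathAlgebra k V := ofPath k α.toPath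

open Classical in
/-- The product of two paths: first `p`, then `q`, if `p` ends where `q` starts, and `0` if not. -/
def pathMul (p q : AllPaths V) : PathAlgebra k V :=
  if h : p.2.1 = q.1 then ofPath k (p.2.2.comp (q.2.2.cast h.symm rfl)) else 0

/-- The bilinear extension of the product of paths. -/
def mulₗ : PathAlgebra k V →ₗ[k] PathAlgebra k V →ₗ[k] PathAlgebra k V :=
  (basis k).constr k fun p => (basis k).constr k fun q => pathMul k p q

instance : Mul (PathAlgebra k V) := ⟨fun x y => mulₗ k x y⟩

theorem mul_def (x y : PathAlgebra k V) : x * y = mulₗ k x y := rfl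

theorem mulₗ_single (p q : AllPaths V) :
    mulₗ k (ofPath k p.2.2) (ofPath k q.2.2) = pathMul k p q := by
  simp only [mulₗ, ofPath, Module.Basis.constr_basis]

theorem ofPath_mul_ofPath {a b c : V} (p : Quiver.Path a b) (q : Quiver.Path b c) :
    ofPath k p * ofPath k q = ofPath k (p.comp q) := by
  have h := mulₗ_single k (⟨a, b, p⟩ : AllPaths V) ⟨b, c, q⟩
  rw [mul_def, h]
  simp [pathMul]

theorem ofPath_mul_ofPath_of_ne {a b c d : V} (p : Quiver.Path a b) (q : Quiver.Path c d)
    (hbc : b ≠ c) : ofPath k p * ofPath k q = 0 := by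
  have h := mulₗ_single k (⟨a, b, p⟩ : AllPaths V) ⟨c, d, q⟩
  rw [mul_def, h]
  simp [pathMul, hbc]

variable {k}

theorem induction_paths {C : PathAlgebra k V → Prop} (x : PathAlgebra k V) (h0 : C 0)
    (hadd : ∀ x y, C x → C y → C (x + y)) (hsmul : ∀ (r : k) x, C x → C (r • x))
    (hp : ∀ {a b : V} (p : Quiver.Path a b), C (ofPath k p)) : C x := by
  have hx : x ∈ Submodule.span k (Set.range (basis k : AllPaths V → PathAlgebra k V)) := by
    rw [(basis k).span_eq]; trivial
  induction hx using Submodule.span_induction with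
  | mem x h =>
    obtain ⟨⟨a, b, p⟩, rfl⟩ := h
    exact hp p
  | zero => exact h0
  | add x y _ _ hx hy => exact hadd x y hx hy
  | smul r x _ hx => exact hsmul r x hx

/-- The unit is the sum of the trivial paths. -/
instance [Fintype V] : One (PathAlgebra k V) := ⟨∑ a : V, idem k a⟩

theorem one_def [Fintype V] : (1 : PathAlgebra k V) = ∑ a : V, idem k a := rfl

theorem add_mul' (x y z : PathAlgebra k V) : (x + y) * z = x * z + y * z := by
  simp [mul_def]

theorem mul_add' (x y z : PathAlgebra k V) : x * (y + z) = x * y + x * z := by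
  simp [mul_def]

theorem zero_mul' (x : PathAlgebra k V) : 0 * x = 0 := by simp [mul_def]

theorem mul_zero' (x : PathAlgebra k V) : x * 0 = 0 := by simp [mul_def]

theorem smul_mul' (r : k) (x y : PathAlgebra k V) : (r • x) * y = r • (x * y) := by
  simp [mul_def]

theorem mul_smul' (r : k) (x y : PathAlgebra k V) : x * (r • y) = r • (x * y) := by
  simp [mul_def]

theorem one_mul' [Fintype V] (x : PathAlgebra k V) : 1 * x = x := by
  refine induction_paths (C := fun x => 1 * x = x) x (mul_zero' _) (fun x y hx hy => by rw [mul_add', hx, hy])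
    (fun r x hx => by rw [mul_smul', hx]) ?_
  intro a b p
  rw [one_def, mul_def, map_sum, LinearMap.sum_apply, Finset.sum_eq_single a]
  · rw [← mul_def, idem, ofPath_mul_ofPath, Quiver.Path.nil_comp]
  · intro c _ hc
    rw [← mul_def, idem, ofPath_mul_ofPath_of_ne k _ _ hc]
  · simp

theorem mul_one' [Fintype V] (x : PathAlgebra k V) : x * 1 = x := by
  refine induction_paths (C := fun x => x * 1 = x) x (zero_mul' _) (fun x y hx hy => by rw [add_mul', hx, hy])
    (fun r x hx => by rw [smul_mul', hx]) ?_
  intro a b p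
  rw [one_def, mul_def, map_sum, Finset.sum_eq_single b]
  · rw [← mul_def, idem, ofPath_mul_ofPath, Quiver.Path.comp_nil]
  · intro c _ hc
    rw [← mul_def, idem, ofPath_mul_ofPath_of_ne k _ _ hc.symm]
  · simp

theorem mul_assoc' (x y z : PathAlgebra k V) : x * y * z = x * (y * z) := by
  refine induction_paths (C := fun x => x * y * z = x * (y * z)) x (by simp only [zero_mul'])
    (fun x x' hx hx' => by simp only [add_mul', hx, hx'])
    (fun r x hx => by simp only [smul_mul', hx]) ?_
  intro a b p
  refine induction_paths (C := fun y => ofPath k p * y * z = ofPath k p * (y * z)) y (by simp only [zero_mul', mul_zero'])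
    (fun x x' hx hx' => by simp only [add_mul', mul_add', hx, hx'])
    (fun r x hx => by simp only [smul_mul', mul_smul', hx]) ?_
  intro c d q
  refine induction_paths
    (C := fun z => ofPath k p * ofPath k q * z = ofPath k p * (ofPath k q * z)) z (by simp only [mul_zero'])
    (fun x x' hx hx' => by simp only [mul_add', hx, hx'])
    (fun r x hx => by simp only [mul_smul', hx]) ?_
  intro e f r
  by_cases h1 : b = c
  · subst h1
    by_cases h2 : d = e
    · subst h2
      simp only [ofPath_mul_ofPath, Quiver.Path.comp_assoc]
    · simp only [ofPath_mul_ofPath, ofPath_mul_ofPath_of_ne k _ _ h2, mul_zero']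
  · by_cases h2 : d = e
    · subst h2
      simp only [ofPath_mul_ofPath, ofPath_mul_ofPath_of_ne k _ _ h1, zero_mul']
    · simp only [ofPath_mul_ofPath_of_ne k _ _ h1, ofPath_mul_ofPath_of_ne k _ _ h2, zero_mul',
        mul_zero']

instance [Fintype V] : Ring (PathAlgebra k V) :=
  { (inferInstance : AddCommGroup (PathAlgebra k V)),
    (inferInstance : Mul (PathAlgebra k V)),
    (inferInstance : One (PathAlgebra k V)) with
    left_distrib := mul_add'
    right_distrib := add_mul'
    zero_mul := zero_mul'
    mul_zero := mul_zero'
    mul_assoc := mul_assoc'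
    one_mul := one_mul'
    mul_one := mul_one' }

instance [Fintype V] : Algebra k (PathAlgebra k V) := Algebra.ofModule smul_mul' mul_smul'

end PathAlgebra

/-- The quotient `kQ/I`, where `I` is the two-sided ideal generated by a set of relations. -/
abbrev BoundQuiverAlgebra (k : Type w) (V : Type u) [Quiver.{v} V] [Field k] [Fintype V]
    (rel : Set (PathAlgebra k V)) : Type (max u v w) :=
  (TwoSidedIdeal.span rel).ringCon.Quotient

end PathAlgebra

/-! ## Trivial extensions -/

section TrivialExtension

/-- The bimodule `D(A) = Hom_k(A, k)`. -/
def DualBimodule (k A : Type*) [Field k] [Ring A] [Algebra k A] : Type _ := A →ₗ[k] k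

namespace DualBimodule

variable {k A : Type*} [Field k] [Ring A] [Algebra k A]

instance : AddCommGroup (DualBimodule k A) := inferInstanceAs (AddCommGroup (A →ₗ[k] k))

instance : Module k (DualBimodule k A) := inferInstanceAs (Module k (A →ₗ[k] k))

instance : FunLike (DualBimodule k A) A k := inferInstanceAs (FunLike (A →ₗ[k] k) A k)

instance : LinearMapClass (DualBimodule k A) k A k :=
  inferInstanceAs (LinearMapClass (A →ₗ[k] k) k A k)

/-- The left action `(a f)(x) = f(x a)`. -/
instance : Module A (DualBimodule k A) where
  smul a f := LinearMap.comp (M₂ := A) f (LinearMap.mulRight k a)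
  one_smul f := LinearMap.ext fun x => congrArg f (mul_one x)
  mul_smul a b f := LinearMap.ext fun x => congrArg f (mul_assoc x a b).symm
  smul_zero _ := rfl
  smul_add _ _ _ := rfl
  add_smul a b f := LinearMap.ext fun x =>
    (congrArg f (mul_add x a b)).trans (map_add f _ _)
  zero_smul f := LinearMap.ext fun x => (congrArg f (mul_zero x)).trans (map_zero f)

/-- The right action `(f a)(x) = f(a x)`. -/
instance : Module Aᵐᵒᵖ (DualBimodule k A) where
  smul a f := LinearMap.comp (M₂ := A) f (LinearMap.mulLeft k a.unop)
  one_smul f := LinearMap.ext fun x => congrArg f (one_mul x)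
  mul_smul a b f := LinearMap.ext fun x => congrArg f (mul_assoc b.unop a.unop x)
  smul_zero _ := rfl
  smul_add _ _ _ := rfl
  add_smul a b f := LinearMap.ext fun x =>
    (congrArg f (add_mul a.unop b.unop x)).trans (map_add f _ _)
  zero_smul f := LinearMap.ext fun x => (congrArg f (zero_mul x)).trans (map_zero f)

theorem smul_apply (a : A) (f : DualBimodule k A) (x : A) : (a • f) x = f (x * a) := rfl

theorem op_smul_apply (a : A) (f : DualBimodule k A) (x : A) :
    (MulOpposite.op a • f) x = f (a * x) := rfl

instance : SMulCommClass A Aᵐᵒᵖ (DualBimodule k A) where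
  smul_comm a b f := LinearMap.ext fun x => congrArg f (mul_assoc b.unop x a).symm

instance : IsScalarTower k A (DualBimodule k A) where
  smul_assoc r a f := LinearMap.ext fun x =>
    (congrArg f (mul_smul_comm r x a)).trans (map_smul f r _)

instance : IsScalarTower k Aᵐᵒᵖ (DualBimodule k A) where
  smul_assoc r a f := LinearMap.ext fun x =>
    (congrArg f (smul_mul_assoc r a.unop x)).trans (map_smul f r _)

end DualBimodule

/-- The trivial extension `T(A) = A ⋉ D(A)`, with `(a, f)(b, g) = (ab, ag + fb)`. -/
abbrev TrivialExtension (k A : Type*) [Field k] [Ring A] [Algebra k A] : Type _ :=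
  TrivSqZeroExt A (DualBimodule k A)

end TrivialExtension
/-! ## Brauer graphs and Brauer graph algebras -/

section BrauerGraph

/-- A Brauer graph with vertices `V` and edges `E`: a finite connected graph, possibly with loops
and multiple edges, with a cyclic ordering of the edges around each vertex and a positive
multiplicity at each vertex. `H` is the type of half-edges (germs of edges). A loop has two
half-edges at the same vertex. The cyclic ordering sends a half-edge at `v` to its direct
successor at `v`. -/
structure BrauerGraph (V E H : Type*) where
  finite : Finite H
  vert : H → V
  vert_surjective : Function.Surjective vert
  edge : H → E
  edge_surjective : Function.Surjective edge
  /-- The other half of the same edge. -/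
  opp : H → H
  opp_opp : ∀ h, opp (opp h) = h
  opp_ne : ∀ h, opp h ≠ h
  edge_eq_iff : ∀ h h', edge h = edge h' ↔ h' = h ∨ h' = opp h
  /-- The direct successor in the cyclic ordering. -/
  succ : Equiv.Perm H
  vert_eq_iff : ∀ h h', vert h = vert h' ↔ succ.SameCycle h h'
  mult : V → ℕ
  mult_pos : ∀ v, 0 < mult v
  connected : ∀ h h', Relation.EqvGen (fun a b => vert a = vert b ∨ edge a = edge b) h h'

namespace BrauerGraph

variable {V E H : Type*} (Γ : BrauerGraph V E H)

/-- The half-edge `h` ends in a leaf vertex (`h` is the only half-edge there) of multiplicity one.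
Such a half-edge gives no arrow. -/
def Truncated (h : H) : Prop := Γ.succ h = h ∧ Γ.mult (Γ.vert h) = 1

/-- The vertices of the quiver of a Brauer graph are its edges. -/
def QuiverVertex (_Γ : BrauerGraph V E H) : Type _ := E

instance [Fintype E] : Fintype Γ.QuiverVertex := inferInstanceAs (Fintype E)

/-- There is one arrow from an edge to its direct successor, for every half-edge `h` that does not
end in a leaf vertex of multiplicity one. -/
instance : Quiver Γ.QuiverVertex where
  Hom i j := {h : H // ¬ Γ.Truncated h ∧ Γ.edge h = i ∧ Γ.edge (Γ.succ h) = j}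

variable (k : Type*) [Field k]

open Classical in
/-- The arrow given by the half-edge `h`, as an element of the path algebra (`0` if there is no
such arrow). -/
def arrow (h : H) : PathAlgebra k Γ.QuiverVertex :=
  if hh : Γ.Truncated h then 0
  else PathAlgebra.ofArrow k (V := Γ.QuiverVertex) (a := Γ.edge h) (b := Γ.edge (Γ.succ h))
    ⟨h, hh, rfl, rfl⟩

variable [Fintype E]

/-- The cycle `C_{ν,i}` that starts with the arrow of the half-edge `h` of the edge `i` at the
vertex `ν`, and runs once around `ν`. -/
def cycle (h : H) : PathAlgebra k Γ.QuiverVertex :=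
  ((List.range (Function.minimalPeriod Γ.succ h)).map fun n => Γ.arrow k (Γ.succ^[n] h)).prod

/-- The power `C_{ν,i}^{e(ν)}`. -/
def cyclePow (h : H) : PathAlgebra k Γ.QuiverVertex :=
  Γ.cycle k h ^ Γ.mult (Γ.vert h)

/-- The relations of a Brauer graph: the two cycles at an edge are equal if neither of its ends is
a leaf vertex of multiplicity one; if one end is such a leaf vertex then the cycle at the other
end, followed by its own first arrow, is zero; the composite of two consecutive arrows that enter
and leave an edge at different half-edges is zero. -/
def relations : Set (PathAlgebra k Γ.QuiverVertex) :=
  {x | ∃ h, ¬ Γ.Truncated h ∧ ¬ Γ.Truncated (Γ.opp h) ∧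
      x = Γ.cyclePow k h - Γ.cyclePow k (Γ.opp h)} ∪
  {x | ∃ h, ¬ Γ.Truncated h ∧ Γ.Truncated (Γ.opp h) ∧ x = Γ.cyclePow k h * Γ.arrow k h} ∪
  {x | ∃ h, ¬ Γ.Truncated h ∧ ¬ Γ.Truncated (Γ.opp (Γ.succ h)) ∧
      x = Γ.arrow k h * Γ.arrow k (Γ.opp (Γ.succ h))}

/-- The Brauer graph algebra. -/
abbrev algebra : Type _ := BoundQuiverAlgebra k Γ.QuiverVertex (Γ.relations k)

end BrauerGraph

end BrauerGraph

/-! ## Surfaces glued from polygons -/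

/-- Finitely many disjoint oriented polygons, with some of their sides glued in pairs.
`next` sends a side of a polygon to the side that follows it counterclockwise, so that the polygons
are the orbits of `next`. `glue` sends a side to the side it is glued to, by a map that reverses
the boundary orientations; the sides with `glue d = d` are not glued. -/
structure PolygonGluing where
  Side : Type
  finite : Finite Side
  next : Equiv.Perm Side
  glue : Side → Side
  glue_glue : ∀ d, glue (glue d) = d

namespace PolygonGluing

variable (G : PolygonGluing)

instance : Finite G.Side := G.finite

/-- The side `d` is a boundary segment. -/
def IsBoundary (d : G.Side) : Prop := G.glue d = d

/-- The point `(d, (r, t))` lies in the sector of a polygon over its side `d`, at distance `r` from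
the centre of the polygon (`r = 1` on the side), in the direction of the point of `d` with
parameter `t`, where `d` is parametrized counterclockwise. -/
abbrev Point : Type := Σ _ : G.Side, unitInterval × unitInterval

/-- The identifications: consecutive sectors form a polygon, and glued sides are identified. -/
inductive Identify : G.Point → G.Point → Prop
  | sector (d : G.Side) (r : unitInterval) : Identify ⟨d, (r, 1)⟩ ⟨G.next d, (r, 0)⟩
  | centre (d : G.Side) (t t' : unitInterval) : Identify ⟨d, (0, t)⟩ ⟨d, (0, t')⟩
  | side (d : G.Side) (hd : ¬ G.IsBoundary d) (t : unitInterval) :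
      Identify ⟨d, (1, t)⟩ ⟨G.glue d, (1, unitInterval.symm t)⟩

/-- The compact oriented surface with boundary obtained by gluing the polygons. -/
def Surface : Type := Quot G.Identify

instance : TopologicalSpace G.Surface := inferInstanceAs (TopologicalSpace (Quot G.Identify))

/-- The point of the side `d` with parameter `t`. -/
def sidePoint (d : G.Side) (t : unitInterval) : G.Surface := Quot.mk _ ⟨d, (1, t)⟩

/-- The vertex of a polygon where its side `d` starts. -/
def vertex (d : G.Side) : G.Surface := G.sidePoint d 0

/-- The boundary of the surface, that is the union of the boundary segments. -/
def boundary : Set G.Surface := {x | ∃ d t, G.IsBoundary d ∧ x = G.sidePoint d t}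

/-- `(S, M)` is a bordered surface `S` with a set `M` of marked points on its boundary, which is
cut into polygons as described by `G`: `S` is identified with the glued surface, and carries its
orientation, and the marked points are the vertices of the polygons. -/
structure Decomposition (S : Type*) [TopologicalSpace S] (M : Set S) where
  homeo : G.Surface ≃ₜ S
  marked : Set.range (fun d => homeo (G.vertex d)) = M
  marked_subset : M ⊆ homeo '' G.boundary

/-- The arcs: pairs of glued sides. -/
def Arc : Type := {e : Sym2 G.Side // ∃ d, ¬ G.IsBoundary d ∧ e = s(d, G.glue d)}

/-- The ends of the arcs. A glued side `d` stands for the end of its arc at the point where `d`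
starts; the other end of the arc is `glue d`. -/
abbrev ArcEnd : Type := {d : G.Side // ¬ G.IsBoundary d}

/-- The arc of an end. -/
def arc (d : G.ArcEnd) : G.Arc := ⟨s(d.1, G.glue d.1), d.1, d.2, rfl⟩

theorem arc_surjective : Function.Surjective G.arc := by
  rintro ⟨e, d, hd, rfl⟩
  exact ⟨⟨d, hd⟩, rfl⟩

instance : Finite G.Arc := Finite.of_surjective _ G.arc_surjective

instance : Fintype G.Arc := Fintype.ofFinite _

/-- The other end of the same arc. -/
def oppEnd (d : G.ArcEnd) : G.ArcEnd :=
  ⟨G.glue d.1, fun h => d.2 (by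
    unfold IsBoundary at h ⊢
    rw [G.glue_glue] at h
    exact h.symm)⟩

theorem arc_eq_iff (d d' : G.ArcEnd) : G.arc d = G.arc d' ↔ d' = d ∨ d' = G.oppEnd d := by
  obtain ⟨d, hd⟩ := d
  obtain ⟨d', hd'⟩ := d'
  have h1 : G.arc ⟨d, hd⟩ = G.arc ⟨d', hd'⟩ ↔ s(d, G.glue d) = s(d', G.glue d') :=
    Subtype.ext_iff
  rw [h1, Sym2.eq_iff, oppEnd, Subtype.mk.injEq, Subtype.mk.injEq]
  constructor
  · rintro (⟨h, _⟩ | ⟨_, h⟩)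
    · exact Or.inl h.symm
    · exact Or.inr h.symm
  · rintro (rfl | rfl)
    · exact Or.inl ⟨rfl, rfl⟩
    · exact Or.inr ⟨(G.glue_glue _).symm, rfl⟩

/-! ### The bound quiver of a decomposition into polygons -/

/-- The vertices of the quiver are the arcs. -/
def QuiverVertex : Type := G.Arc

instance : Fintype G.QuiverVertex := inferInstanceAs (Fintype G.Arc)

/-- There is one arrow from `i` to `j` for every polygon and every pair of consecutive sides `d`,
`next d` of it (counterclockwise) that are the arcs `i` and `j`. -/
instance : Quiver G.QuiverVertex where
  Hom i j := {d : G.Side // ∃ (h : ¬ G.IsBoundary d) (h' : ¬ G.IsBoundary (G.next d)),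
    G.arc ⟨d, h⟩ = i ∧ G.arc ⟨G.next d, h'⟩ = j}

/-- The arrow in the corner between the sides `d` and `next d`. -/
def cornerArrow (k : Type*) [Field k] (d : G.Side) (h : ¬ G.IsBoundary d)
    (h' : ¬ G.IsBoundary (G.next d)) : PathAlgebra k G.QuiverVertex :=
  PathAlgebra.ofArrow k (V := G.QuiverVertex) (a := G.arc ⟨d, h⟩) (b := G.arc ⟨G.next d, h'⟩)
    ⟨d, h, h', rfl, rfl⟩

/-- The relations: the composite of two arrows in consecutive corners of the same polygon is
zero. -/
def cornerRelations (k : Type*) [Field k] : Set (PathAlgebra k G.QuiverVertex) :=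
  {x | ∃ (d : G.Side) (h : ¬ G.IsBoundary d) (h' : ¬ G.IsBoundary (G.next d))
    (h'' : ¬ G.IsBoundary (G.next (G.next d))),
    x = G.cornerArrow k d h h' * G.cornerArrow k (G.next d) h' h''}

/-- The algebra `kQ/I` of a decomposition of a surface into polygons. -/
abbrev algebra (k : Type*) [Field k] : Type _ :=
  BoundQuiverAlgebra k G.QuiverVertex (G.cornerRelations k)

/-! ### The cyclic ordering of the ends of arcs around a marked point -/

/-- `glue` as a permutation. -/
def gluePerm : Equiv.Perm G.Side := ⟨G.glue, G.glue, G.glue_glue, G.glue_glue⟩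

/-- If `d` is a glued side then `cw d` is the side that starts at the same point as `d` and comes
next in clockwise order. -/
def cw : Equiv.Perm G.Side := G.gluePerm.trans G.next

theorem cw_apply (d : G.Side) : G.cw d = G.next (G.glue d) := rfl

/-- The number of ends of arcs to turn over counterclockwise, starting from the end `d`, before
one meets the boundary segment that arrives at the same marked point. -/
def fanIndex (d : G.Side) : ℕ := sInf {n | G.IsBoundary ((G.cw⁻¹ ^ (n + 1)) d)}

/-- The first end, in clockwise order, at the marked point of `d`. -/
def fanStart (d : G.Side) : G.Side := (G.cw⁻¹ ^ G.fanIndex d) d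

theorem cw_cw_inv (d : G.Side) : G.cw (G.cw⁻¹ d) = d := G.cw.apply_symm_apply d

theorem cw_inv_cw (d : G.Side) : G.cw⁻¹ (G.cw d) = d := G.cw.symm_apply_apply d

theorem fanIndex_spec {d : G.Side} (h : G.IsBoundary (G.cw d)) :
    G.IsBoundary ((G.cw⁻¹ ^ (G.fanIndex d + 1)) d) := by
  have hne : {n | G.IsBoundary ((G.cw⁻¹ ^ (n + 1)) d)}.Nonempty := by
    obtain ⟨N, hN, hN1⟩ := (isOfFinOrder_of_finite G.cw⁻¹).exists_pow_eq_one
    refine ⟨N + N - 2, ?_⟩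
    have h2 : G.cw⁻¹ ^ (N + N - 2 + 1) = G.cw := by
      have h3 : N + N - 2 + 1 + 1 = N + N := by omega
      have h4 : G.cw⁻¹ ^ (N + N - 2 + 1) * G.cw⁻¹ = 1 := by
        rw [← pow_succ, h3, pow_add, hN1, one_mul]
      simpa using eq_inv_of_mul_eq_one_left h4
    simp only [Set.mem_ofPred_eq, h2]
    exact h
  exact Nat.sInf_mem hne

theorem not_isBoundary_of_le {d : G.Side} (hd : ¬ G.IsBoundary d) {m : ℕ}
    (hm : m ≤ G.fanIndex d) : ¬ G.IsBoundary ((G.cw⁻¹ ^ m) d) := by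
  cases m with
  | zero => simpa using hd
  | succ m => exact fun h => Nat.notMem_of_lt_sInf (Nat.lt_of_succ_le hm) h

open Classical in
/-- The direct successor of an end in the clockwise cyclic ordering around its marked point. The
last end before the boundary is followed by the first end. -/
def succFun (d : G.ArcEnd) : G.ArcEnd :=
  if h : G.IsBoundary (G.cw d.1) then ⟨G.fanStart d.1, G.not_isBoundary_of_le d.2 le_rfl⟩
  else ⟨G.cw d.1, h⟩

theorem succFun_of_not {d : G.ArcEnd} (h : ¬ G.IsBoundary (G.cw d.1)) :
    G.succFun d = ⟨G.cw d.1, h⟩ := by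
  simp [succFun, h]

theorem succFun_of {d : G.ArcEnd} (h : G.IsBoundary (G.cw d.1)) :
    G.succFun d = ⟨G.fanStart d.1, G.not_isBoundary_of_le d.2 le_rfl⟩ := by
  simp [succFun, h]

theorem cw_inv_fanStart (d : G.Side) :
    G.cw⁻¹ (G.fanStart d) = (G.cw⁻¹ ^ (G.fanIndex d + 1)) d := by
  rw [fanStart, pow_succ', Equiv.Perm.mul_apply]

theorem fanStart_inj_aux {d d' : G.Side} (hd' : ¬ G.IsBoundary d') (h : G.IsBoundary (G.cw d))
    (hle : G.fanIndex d ≤ G.fanIndex d') (he : G.fanStart d = G.fanStart d') : d = d' := by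
  obtain ⟨c, hc⟩ := Nat.exists_eq_add_of_le hle
  have h1 : d = (G.cw⁻¹ ^ c) d' := by
    have h2 := he
    rw [fanStart, fanStart, hc, pow_add, Equiv.Perm.mul_apply] at h2
    exact (G.cw⁻¹ ^ G.fanIndex d).injective h2
  cases c with
  | zero => simpa using h1
  | succ c =>
    exfalso
    rw [pow_succ', Equiv.Perm.mul_apply] at h1
    rw [h1, cw_cw_inv] at h
    exact G.not_isBoundary_of_le hd' (by omega) h

theorem succFun_injective : Function.Injective G.succFun := by
  intro d d' he
  by_cases h : G.IsBoundary (G.cw d.1) <;> by_cases h' : G.IsBoundary (G.cw d'.1)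
  · rw [G.succFun_of h, G.succFun_of h'] at he
    have he' : G.fanStart d.1 = G.fanStart d'.1 := congrArg Subtype.val he
    rcases le_total (G.fanIndex d.1) (G.fanIndex d'.1) with hle | hle
    · exact Subtype.ext (G.fanStart_inj_aux d'.2 h hle he')
    · exact Subtype.ext (G.fanStart_inj_aux d.2 h' hle he'.symm).symm
  · rw [G.succFun_of h, G.succFun_of_not h'] at he
    have he' : G.fanStart d.1 = G.cw d'.1 := congrArg Subtype.val he
    have h1 := G.fanIndex_spec h
    rw [← cw_inv_fanStart, he', cw_inv_cw] at h1
    exact absurd h1 d'.2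
  · rw [G.succFun_of_not h, G.succFun_of h'] at he
    have he' : G.cw d.1 = G.fanStart d'.1 := congrArg Subtype.val he
    have h1 := G.fanIndex_spec h'
    rw [← cw_inv_fanStart, ← he', cw_inv_cw] at h1
    exact absurd h1 d.2
  · rw [G.succFun_of_not h, G.succFun_of_not h'] at he
    exact Subtype.ext (G.cw.injective (congrArg Subtype.val he))

/-- The clockwise cyclic ordering of the ends of arcs around each marked point. -/
def succ : Equiv.Perm G.ArcEnd :=
  Equiv.ofBijective G.succFun (Finite.injective_iff_bijective.mp G.succFun_injective)

theorem succ_apply (d : G.ArcEnd) : G.succ d = G.succFun d := rfl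

/-- Turning clockwise over one glued side. -/
def Turn (d d' : G.Side) : Prop := ¬ G.IsBoundary d ∧ d' = G.cw d

theorem vertex_eq_of_turn {d d' : G.Side} (h : G.Turn d d') : G.vertex d = G.vertex d' := by
  obtain ⟨hd, rfl⟩ := h
  have h1 := Quot.sound (Identify.side d hd 0)
  have h2 := Quot.sound (Identify.sector (G.glue d) 1)
  rw [unitInterval.symm_zero] at h1
  exact h1.trans h2

open Classical in
/-- The vertex of a polygon at a given point, up to turning around it, if there is one. -/
def vertexClass (x : G.Point) : Option (Quot G.Turn) :=
  if x.2.1 = 1 ∧ x.2.2 = 0 then some (Quot.mk _ x.1)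
  else if x.2.1 = 1 ∧ x.2.2 = 1 then some (Quot.mk _ (G.next x.1)) else none

theorem vertexClass_eq {x y : G.Point} (h : G.Identify x y) :
    G.vertexClass x = G.vertexClass y := by
  induction h with
  | sector d r => by_cases hr : r = 1 <;> simp [vertexClass, hr]
  | centre d t t' => simp [vertexClass]
  | side d hd t =>
    have h1 : Quot.mk G.Turn d = Quot.mk G.Turn (G.next (G.glue d)) := Quot.sound ⟨hd, rfl⟩
    by_cases h0 : t = 0
    · subst h0
      simp [vertexClass, h1]
    · by_cases ht : t = 1
      · subst ht
        have h2 : Quot.mk G.Turn (G.glue d) = Quot.mk G.Turn (G.next d) := by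
          have h3 := Quot.sound (r := G.Turn) (a := G.glue d) (b := G.cw (G.glue d))
            ⟨(G.oppEnd ⟨d, hd⟩).2, rfl⟩
          rw [h3, cw_apply, G.glue_glue]
        simp [vertexClass, h2]
      · have h2 : unitInterval.symm t ≠ 0 := fun h => ht (by
          rw [← unitInterval.symm_symm t, h, unitInterval.symm_zero])
        have h3 : unitInterval.symm t ≠ 1 := fun h => h0 (by
          rw [← unitInterval.symm_symm t, h, unitInterval.symm_one])
        simp [vertexClass, h0, ht, h2, h3]

theorem vertex_eq_iff (d d' : G.Side) :
    G.vertex d = G.vertex d' ↔ Quot.mk G.Turn d = Quot.mk G.Turn d' := by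
  constructor
  · intro h
    have h1 := congrArg (Quot.lift G.vertexClass fun _ _ => G.vertexClass_eq) h
    simpa [vertex, sidePoint, vertexClass] using h1
  · exact fun h => congrArg (Quot.lift G.vertex fun _ _ => G.vertex_eq_of_turn) h

theorem vertex_cw_inv_pow {d : G.Side} (hd : ¬ G.IsBoundary d) {m : ℕ} (hm : m ≤ G.fanIndex d) :
    G.vertex ((G.cw⁻¹ ^ m) d) = G.vertex d := by
  induction m with
  | zero => rfl
  | succ m ih =>
    rw [← ih (by omega)]
    refine G.vertex_eq_of_turn ⟨G.not_isBoundary_of_le hd hm, ?_⟩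
    rw [pow_succ', Equiv.Perm.mul_apply, cw_cw_inv]

theorem vertex_succ (d : G.ArcEnd) : G.vertex (G.succ d).1 = G.vertex d.1 := by
  rw [succ_apply]
  by_cases h : G.IsBoundary (G.cw d.1)
  · rw [G.succFun_of h]
    exact G.vertex_cw_inv_pow d.2 le_rfl
  · rw [G.succFun_of_not h]
    exact (G.vertex_eq_of_turn ⟨d.2, rfl⟩).symm

open Classical in
/-- The orbit of the cyclic ordering to which a side belongs (a boundary segment `b` belongs to
the orbit of the end that precedes it), if there is one. -/
def fanClass (d : G.Side) : Option (Quotient (Equiv.Perm.SameCycle.setoid G.succ)) :=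
  if h : G.IsBoundary d then
    if h' : G.IsBoundary (G.cw⁻¹ d) then none else some (Quotient.mk _ ⟨G.cw⁻¹ d, h'⟩)
  else some (Quotient.mk _ ⟨d, h⟩)

theorem fanClass_eq_of_turn {d d' : G.Side} (h : G.Turn d d') : G.fanClass d = G.fanClass d' := by
  obtain ⟨hd, rfl⟩ := h
  by_cases h : G.IsBoundary (G.cw d)
  · simp [fanClass, hd, h]
  · simp only [fanClass, hd, h, dite_false]
    refine congrArg some (Quotient.sound ⟨1, ?_⟩)
    rw [zpow_one, succ_apply, G.succFun_of_not (d := ⟨d, hd⟩) h]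

theorem vertex_eq_iff_sameCycle (d d' : G.ArcEnd) :
    G.vertex d.1 = G.vertex d'.1 ↔ G.succ.SameCycle d d' := by
  constructor
  · intro h
    rw [vertex_eq_iff] at h
    have h1 := congrArg (Quot.lift G.fanClass fun _ _ => G.fanClass_eq_of_turn) h
    have hd : ¬ G.IsBoundary d.1 := d.2
    have hd' : ¬ G.IsBoundary d'.1 := d'.2
    simp only [fanClass, hd, hd', dite_false, Option.some.injEq] at h1
    exact Quotient.exact h1
  · intro h
    obtain ⟨n, hn⟩ := h.exists_nat_pow_eq
    rw [← hn]
    clear hn h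
    induction n with
    | zero => rfl
    | succ n ih => rw [pow_succ', Equiv.Perm.mul_apply, vertex_succ, ih]

/-! ### Connectedness -/

theorem mem_of_connected [ConnectedSpace G.Surface] (C : Set G.Side)
    (hnext : ∀ d, d ∈ C ↔ G.next d ∈ C) (hglue : ∀ d, ¬ G.IsBoundary d → d ∈ C → G.glue d ∈ C)
    {d₀ : G.Side} (h₀ : d₀ ∈ C) (d : G.Side) : d ∈ C := by
  classical
  have hinv : ∀ x y : G.Point, G.Identify x y → decide (x.1 ∈ C) = decide (y.1 ∈ C) := by
    intro x y h
    induction h with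
    | sector d r => simp [hnext d]
    | centre d t t' => rfl
    | side d hd t =>
      have h1 : d ∈ C ↔ G.glue d ∈ C := by
        refine ⟨hglue d hd, fun h => ?_⟩
        have h2 := hglue (G.glue d) (G.oppEnd ⟨d, hd⟩).2 h
        rwa [G.glue_glue] at h2
      simp [h1]
  let f : G.Surface → Bool := Quot.lift (fun x : G.Point => decide (x.1 ∈ C)) hinv
  have hcont : Continuous f :=
    continuous_quot_lift hinv (continuous_sigma fun d => continuous_const (y := decide (d ∈ C)))
  have h1 : f (G.vertex d₀) = f (G.vertex d) :=
    PreconnectedSpace.constant (α := G.Surface) inferInstance hcont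
      (x := G.vertex d₀) (y := G.vertex d)
  have h2 : decide (d₀ ∈ C) = decide (d ∈ C) := h1
  simpa [h₀] using h2

end PolygonGluing

/-! ## Triangulations, cuts and surface algebras -/

/-- An ideal triangulation of a bordered surface `S` with a set `M` of marked points on the
boundary: a decomposition of `(S, M)` into triangles. -/
structure IdealTriangulation (S : Type*) [TopologicalSpace S] (M : Set S) where
  gluing : PolygonGluing
  decomposition : gluing.Decomposition S M
  next_ne : ∀ d, gluing.next d ≠ d
  next_three : ∀ d, gluing.next (gluing.next (gluing.next d)) = d

namespace IdealTriangulation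

variable {S : Type*} [TopologicalSpace S] {M : Set S} (T : IdealTriangulation S M)

/-- A choice of corners at which internal triangles are cut, so that every internal triangle is cut
at most once. A side `d` in `corners` stands for the corner between `d` and `next d`. A triangle
is internal if none of its sides is a boundary segment. -/
structure Cut where
  corners : Set T.gluing.Side
  internal : ∀ d ∈ corners, ¬ T.gluing.IsBoundary d ∧ ¬ T.gluing.IsBoundary (T.gluing.next d) ∧
    ¬ T.gluing.IsBoundary (T.gluing.next (T.gluing.next d))
  once : ∀ d ∈ corners, T.gluing.next d ∉ corners ∧ T.gluing.next (T.gluing.next d) ∉ corners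

variable {T}

namespace Cut

variable (χ : T.Cut)

open Classical in
/-- The sides of the cut polygons in counterclockwise order. Cutting the corner between `d` and
`next d` replaces the marked point there by two marked points, joined by a new boundary segment
that comes between `d` and `next d`; the triangle becomes a quadrilateral. -/
def next : Equiv.Perm (T.gluing.Side ⊕ χ.corners) where
  toFun := Sum.elim
    (fun d => if h : d ∈ χ.corners then Sum.inr ⟨d, h⟩ else Sum.inl (T.gluing.next d))
    (fun c => Sum.inl (T.gluing.next c.1))
  invFun := Sum.elim
    (fun d => if h : T.gluing.next.symm d ∈ χ.corners then Sum.inr ⟨T.gluing.next.symm d, h⟩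
      else Sum.inl (T.gluing.next.symm d))
    (fun c => Sum.inl c.1)
  left_inv := by
    rintro (d | ⟨d, hd⟩)
    · by_cases h : d ∈ χ.corners <;> simp [h]
    · simp [hd]
  right_inv := by
    rintro (d | ⟨d, hd⟩)
    · by_cases h : T.gluing.next.symm d ∈ χ.corners <;> simp [h]
    · simp [hd]

/-- The polygons of the partial triangulation obtained by the cut. The new boundary segments are
not glued, and the other sides are glued as before. -/
def gluing : PolygonGluing where
  Side := T.gluing.Side ⊕ χ.corners
  finite := inferInstance
  next := χ.next
  glue := Sum.map T.gluing.glue id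
  glue_glue := by
    rintro (d | c)
    · simp [T.gluing.glue_glue]
    · rfl

/-- A partial triangulation `P` of `(S, M')` that is given by the cut `χ` of a triangulation `T` of
`(S, M)`, where `M'` is the set of marked points after the cut. -/
abbrev PartialTriangulation (M' : Set S) : Type _ := χ.gluing.Decomposition S M'

/-- The surface algebra of the partial triangulation given by the cut. -/
abbrev surfaceAlgebra (k : Type*) [Field k] : Type _ := χ.gluing.algebra k

theorem isBoundary_inl (d : T.gluing.Side) :
    χ.gluing.IsBoundary (Sum.inl d) ↔ T.gluing.IsBoundary d :=
  Sum.inl_injective.eq_iff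

theorem isBoundary_inr (c : χ.corners) : χ.gluing.IsBoundary (Sum.inr c) := rfl

theorem next_inl {d : T.gluing.Side} (h : d ∉ χ.corners) :
    χ.gluing.next (Sum.inl d) = Sum.inl (T.gluing.next d) := by
  exact dif_neg h

/-- Two ends are joined by a walk along arcs. -/
def Joined (a b : χ.gluing.ArcEnd) : Prop :=
  Relation.EqvGen (fun a b : χ.gluing.ArcEnd =>
    χ.gluing.vertex a.1 = χ.gluing.vertex b.1 ∨ χ.gluing.arc a = χ.gluing.arc b) a b

/-- An end of an arc of `T` as an end of an arc after the cut. -/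
def lift (d : T.gluing.Side) (h : ¬ T.gluing.IsBoundary d) : χ.gluing.ArcEnd :=
  ⟨Sum.inl d, fun h' => h ((χ.isBoundary_inl d).mp h')⟩

theorem joined_glue {d : T.gluing.Side} (h : ¬ T.gluing.IsBoundary d)
    (h' : ¬ T.gluing.IsBoundary (T.gluing.glue d)) :
    χ.Joined (χ.lift d h) (χ.lift (T.gluing.glue d) h') :=
  Relation.EqvGen.rel _ _ (Or.inr ((χ.gluing.arc_eq_iff _ _).mpr (Or.inr rfl)))

theorem joined_of_not_mem {d : T.gluing.Side} (hc : d ∉ χ.corners)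
    (h : ¬ T.gluing.IsBoundary d) (h' : ¬ T.gluing.IsBoundary (T.gluing.next d)) :
    χ.Joined (χ.lift d h) (χ.lift (T.gluing.next d) h') := by
  have hg : ¬ T.gluing.IsBoundary (T.gluing.glue d) := (T.gluing.oppEnd ⟨d, h⟩).2
  refine Relation.EqvGen.trans _ _ _ (χ.joined_glue h hg) (Relation.EqvGen.rel _ _ (Or.inl ?_))
  refine χ.gluing.vertex_eq_of_turn ⟨(χ.lift _ hg).2, ?_⟩
  rw [PolygonGluing.cw_apply]
  change Sum.inl (T.gluing.next d)
    = χ.gluing.next (Sum.inl (T.gluing.glue (T.gluing.glue d)))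
  rw [T.gluing.glue_glue, χ.next_inl hc]

theorem joined_next {d : T.gluing.Side}
    (h : ¬ T.gluing.IsBoundary d) (h' : ¬ T.gluing.IsBoundary (T.gluing.next d)) :
    χ.Joined (χ.lift d h) (χ.lift (T.gluing.next d) h') := by
  by_cases hc : d ∈ χ.corners
  · have h'' := (χ.internal d hc).2.2
    have h3 : ¬ T.gluing.IsBoundary (T.gluing.next (T.gluing.next (T.gluing.next d))) := by
      rw [T.next_three]; exact h
    have h4 := χ.joined_of_not_mem (χ.once d hc).1 h' h''
    have h5 := χ.joined_of_not_mem (χ.once d hc).2 h'' h3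
    have h6 := Relation.EqvGen.symm _ _ (Relation.EqvGen.trans _ _ _ h4 h5)
    have h7 : χ.lift _ h3 = χ.lift d h := Subtype.ext (congrArg Sum.inl (T.next_three d))
    rwa [h7] at h6
  · exact χ.joined_of_not_mem hc h h'

theorem joined_next_next {d : T.gluing.Side} (h : ¬ T.gluing.IsBoundary d)
    (h' : ¬ T.gluing.IsBoundary (T.gluing.next (T.gluing.next d))) :
    χ.Joined (χ.lift d h) (χ.lift (T.gluing.next (T.gluing.next d)) h') := by
  have h3 : ¬ T.gluing.IsBoundary (T.gluing.next (T.gluing.next (T.gluing.next d))) := by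
    rw [T.next_three]; exact h
  have h6 := Relation.EqvGen.symm _ _ (χ.joined_next h' h3)
  have h7 : χ.lift _ h3 = χ.lift d h := Subtype.ext (congrArg Sum.inl (T.next_three d))
  rwa [h7] at h6

theorem joined [ConnectedSpace S] (a b : χ.gluing.ArcEnd) : χ.Joined a b := by
  obtain ⟨a | c, ha⟩ := a
  swap
  · exact absurd (χ.isBoundary_inr c) ha
  obtain ⟨b | c, hb⟩ := b
  swap
  · exact absurd (χ.isBoundary_inr c) hb
  have ha' : ¬ T.gluing.IsBoundary a := fun h => ha ((χ.isBoundary_inl a).mpr h)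
  have hb' : ¬ T.gluing.IsBoundary b := fun h => hb ((χ.isBoundary_inl b).mpr h)
  have : ConnectedSpace T.gluing.Surface :=
    T.decomposition.homeo.symm.surjective.connectedSpace T.decomposition.homeo.symm.continuous
  let R : T.gluing.Side → Prop := fun d => ∃ h, χ.Joined (χ.lift a ha') (χ.lift d h)
  let C : Set T.gluing.Side :=
    {d | R d ∨ R (T.gluing.next d) ∨ R (T.gluing.next (T.gluing.next d))}
  have hC : ∀ d (h : ¬ T.gluing.IsBoundary d), d ∈ C → R d := by
    rintro d h (h1 | ⟨h1, h2⟩ | ⟨h1, h2⟩)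
    · exact h1
    · exact ⟨h, Relation.EqvGen.trans _ _ _ h2 (Relation.EqvGen.symm _ _ (χ.joined_next h h1))⟩
    · exact ⟨h, Relation.EqvGen.trans _ _ _ h2
        (Relation.EqvGen.symm _ _ (χ.joined_next_next h h1))⟩
  have hb'' : b ∈ C := by
    refine T.gluing.mem_of_connected C ?_ ?_ (d₀ := a) ?_ b
    · intro d
      simp only [C, Set.mem_ofPred_eq, T.next_three]
      tauto
    · intro d h hd
      obtain ⟨_, h2⟩ := hC d h hd
      have hg : ¬ T.gluing.IsBoundary (T.gluing.glue d) := (T.gluing.oppEnd ⟨d, h⟩).2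
      exact Or.inl ⟨hg, Relation.EqvGen.trans _ _ _ h2 (χ.joined_glue h hg)⟩
    · exact Or.inl ⟨ha', Relation.EqvGen.refl _⟩
  exact (hC b hb' hb'').2

namespace PartialTriangulation

variable {χ} {M' : Set S} (P : χ.PartialTriangulation M')

/-- The vertices of the partial triangulation as a graph: the marked points that are endpoints of
arcs. -/
def Vertex : Type _ := {p : M' // ∃ d : χ.gluing.ArcEnd, P.homeo (χ.gluing.vertex d.1) = p.1}

/-- The marked point at an end of an arc. -/
def endpoint (d : χ.gluing.ArcEnd) : Vertex P :=
  ⟨⟨P.homeo (χ.gluing.vertex d.1), P.marked.subset (Set.mem_range_self d.1)⟩, d, rfl⟩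

theorem endpoint_eq_iff (d d' : χ.gluing.ArcEnd) :
    endpoint P d = endpoint P d' ↔ χ.gluing.vertex d.1 = χ.gluing.vertex d'.1 := by
  refine ⟨fun h => P.homeo.injective (congrArg (fun p => p.1.1) h), fun h => ?_⟩
  exact Subtype.ext (Subtype.ext (congrArg P.homeo h))

/-- The partial triangulation `P` as a Brauer graph: its vertices are marked points, its edges are
the arcs, the cyclic orderings are clockwise for the orientation of the surface, and all
multiplicities are one. -/
def brauerGraph [ConnectedSpace S] : BrauerGraph (Vertex P) χ.gluing.Arc χ.gluing.ArcEnd where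
  finite := inferInstance
  vert := endpoint P
  vert_surjective := by
    rintro ⟨⟨p, hp⟩, d, hd⟩
    exact ⟨d, Subtype.ext (Subtype.ext hd)⟩
  edge := χ.gluing.arc
  edge_surjective := χ.gluing.arc_surjective
  opp := χ.gluing.oppEnd
  opp_opp d := Subtype.ext (χ.gluing.glue_glue d.1)
  opp_ne d h := d.2 (congrArg Subtype.val h)
  edge_eq_iff := χ.gluing.arc_eq_iff
  succ := χ.gluing.succ
  vert_eq_iff d d' := (endpoint_eq_iff P d d').trans (χ.gluing.vertex_eq_iff_sameCycle d d')
  mult _ := 1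
  mult_pos _ := Nat.one_pos
  connected := by
    simp only [endpoint_eq_iff]
    exact χ.joined

end PartialTriangulation

end Cut

end IdealTriangulation

end

noncomputable section

namespace PathAlgebra

universe u v w

variable {k : Type w} {V : Type u} [Quiver.{v} V] [Field k]

theorem idem_mul_ofPath {a b : V} (p : Quiver.Path a b) : idem k a * ofPath k p = ofPath k p := by
  rw [idem, ofPath_mul_ofPath, Quiver.Path.nil_comp]

theorem ofPath_mul_idem {a b : V} (p : Quiver.Path a b) : ofPath k p * idem k b = ofPath k p := by
  rw [idem, ofPath_mul_ofPath, Quiver.Path.comp_nil]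

theorem idem_mul_idem_of_ne {a b : V} (h : a ≠ b) : idem k a * idem k b = 0 :=
  ofPath_mul_ofPath_of_ne k _ _ h

theorem ofPath_cons {a b c : V} (p : Quiver.Path a b) (α : b ⟶ c) :
    ofPath k (p.cons α) = ofPath k p * ofArrow k α := by
  rw [ofArrow, ofPath_mul_ofPath]; rfl

section Lift

variable {R : Type*} [Ring R] [Algebra k R] (e : V → R)
  (x : ∀ {a b : V}, (a ⟶ b) → R)

/-- The image of a path, when trivial paths and arrows are sent to given elements. -/
def evalPath : ∀ {a b : V}, Quiver.Path a b → R
  | a, _, .nil => e a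
  | _, _, .cons p α => evalPath p * x α

/-- The linear extension of `evalPath`. -/
def evalₗ : PathAlgebra k V →ₗ[k] R :=
  (basis k).constr k fun p : AllPaths V => evalPath e x p.2.2

theorem evalₗ_ofPath {a b : V} (p : Quiver.Path a b) :
    evalₗ (k := k) e x (ofPath k p) = evalPath e x p := by
  simp only [evalₗ, ofPath, Module.Basis.constr_basis]

variable {e x}

theorem evalPath_mul_idem (he : ∀ a, e a * e a = e a) (hx : ∀ {a b : V} (α : a ⟶ b), x α * e b = x α)
    {a b : V} (p : Quiver.Path a b) : evalPath e x p * e b = evalPath e x p := by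
  cases p with
  | nil => rw [evalPath, he]
  | cons p α => rw [evalPath, mul_assoc, hx]

theorem idem_mul_evalPath (he : ∀ a, e a * e a = e a) {a b : V} (p : Quiver.Path a b) :
    e a * evalPath e x p = evalPath e x p := by
  induction p with
  | nil => rw [evalPath, he]
  | cons p α ih => rw [evalPath, ← mul_assoc, ih]

theorem evalPath_comp (he : ∀ a, e a * e a = e a) (hx : ∀ {a b : V} (α : a ⟶ b), x α * e b = x α)
    {a b c : V} (p : Quiver.Path a b) (q : Quiver.Path b c) :
    evalPath e x (p.comp q) = evalPath e x p * evalPath e x q := by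
  induction q with
  | nil => rw [Quiver.Path.comp_nil, evalPath, evalPath_mul_idem he hx]
  | cons q α ih => rw [Quiver.Path.comp_cons, evalPath, evalPath, ih, mul_assoc]

variable [Fintype V]

variable (e x) in
/-- The universal property of the path algebra. -/
def lift (he : ∀ a, e a * e a = e a) (hne : ∀ a b, a ≠ b → e a * e b = 0) (h1 : ∑ a, e a = 1)
    (hr : ∀ {a b : V} (α : a ⟶ b), x α * e b = x α) : PathAlgebra k V →ₐ[k] R :=
  AlgHom.ofLinearMap (evalₗ e x)
    (by
      rw [one_def, map_sum, ← h1]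
      exact Finset.sum_congr rfl fun a _ => by rw [idem, evalₗ_ofPath, evalPath])
    (by
      intro y z
      refine induction_paths (C := fun y => evalₗ e x (y * z) = evalₗ e x y * evalₗ e x z) y
        (by simp) (fun y y' h h' => by rw [add_mul, map_add, h, h', map_add, add_mul])
        (fun r y h => by rw [smul_mul_assoc, map_smul, h, map_smul, smul_mul_assoc]) ?_
      intro a b p
      refine induction_paths
        (C := fun z => evalₗ e x (ofPath k p * z) = evalₗ e x (ofPath k p) * evalₗ e x z) z
        (by simp) (fun y y' h h' => by rw [mul_add, map_add, h, h', map_add, mul_add])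
        (fun r y h => by rw [mul_smul_comm, map_smul, h, map_smul, mul_smul_comm]) ?_
      intro c d q
      by_cases h : b = c
      · subst h
        rw [ofPath_mul_ofPath]
        simp only [evalₗ_ofPath]
        exact evalPath_comp he hr p q
      · rw [ofPath_mul_ofPath_of_ne k p q h, map_zero]
        simp only [evalₗ_ofPath]
        rw [← evalPath_mul_idem he hr p, ← idem_mul_evalPath he q, mul_assoc,
          ← mul_assoc (e b), hne b c h, zero_mul, mul_zero])

variable (he : ∀ a, e a * e a = e a) (hne : ∀ a b, a ≠ b → e a * e b = 0) (h1 : ∑ a, e a = 1)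
  (hr : ∀ {a b : V} (α : a ⟶ b), x α * e b = x α)

theorem lift_idem (a : V) : lift (k := k) e x he hne h1 hr (idem k a) = e a :=
  (evalₗ_ofPath e x _).trans (by rw [evalPath])

theorem lift_ofArrow {a b : V} (α : a ⟶ b) (hl : e a * x α = x α) :
    lift (k := k) e x he hne h1 hr (ofArrow k α) = x α :=
  (evalₗ_ofPath e x _).trans (by rw [Quiver.Hom.toPath, evalPath, evalPath, hl])

end Lift

end PathAlgebra

namespace BoundQuiverAlgebra

universe u v w

variable {k : Type w} {V : Type u} [Quiver.{v} V] [Field k] [Fintype V]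
  {rel : Set (PathAlgebra k V)}

variable (rel) in
/-- The projection of the path algebra onto a bound quiver algebra. -/
def mk : PathAlgebra k V →ₐ[k] BoundQuiverAlgebra k V rel := RingCon.mkₐ k _

theorem mk_surjective : Function.Surjective (mk rel) := RingCon.mk'_surjective _

theorem mk_eq_zero {x : PathAlgebra k V} (hx : x ∈ rel) : mk rel x = 0 :=
  (RingCon.eq _).mpr (TwoSidedIdeal.subset_span hx)

/-- The universal property of a bound quiver algebra. -/
def lift {R : Type*} [Ring R] [Algebra k R] (f : PathAlgebra k V →ₐ[k] R)
    (hf : ∀ x ∈ rel, f x = 0) : BoundQuiverAlgebra k V rel →ₐ[k] R :=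
  RingCon.liftₐ _ f (by
    have h : TwoSidedIdeal.span rel ≤ TwoSidedIdeal.ker f :=
      TwoSidedIdeal.span_le.mpr fun x hx => (TwoSidedIdeal.mem_ker f).mpr (hf x hx)
    intro x y hxy
    exact TwoSidedIdeal.ringCon_le_iff.mp h hxy)

/-- A subspace that contains the unit and is stable under trivial paths and arrows is everything. -/
theorem eq_top_of_mul_mem (U : Submodule k (BoundQuiverAlgebra k V rel)) (h1 : 1 ∈ U)
    (he : ∀ (a : V), ∀ u ∈ U, mk rel (PathAlgebra.idem k a) * u ∈ U)
    (hx : ∀ {a b : V} (α : a ⟶ b), ∀ u ∈ U, mk rel (PathAlgebra.ofArrow k α) * u ∈ U) : U = ⊤ := by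
  have key : ∀ {a b : V} (p : Quiver.Path a b), ∀ u ∈ U, mk rel (PathAlgebra.ofPath k p) * u ∈ U := by
    intro a b p
    induction p with
    | nil => exact he a
    | cons p α ih =>
      intro u hu
      rw [PathAlgebra.ofPath_cons, map_mul, mul_assoc]
      exact ih _ (hx α u hu)
  rw [eq_top_iff]
  rintro y -
  obtain ⟨y, rfl⟩ := mk_surjective y
  refine PathAlgebra.induction_paths (C := fun y => mk rel y ∈ U) y (by rw [map_zero]; exact U.zero_mem)
    (fun y z hy hz => by rw [map_add]; exact U.add_mem hy hz)
    (fun r y hy => by rw [map_smul]; exact U.smul_mem r hy) ?_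
  intro a b p
  simpa using key p 1 h1

end BoundQuiverAlgebra

namespace BrauerGraph

variable {V E H : Type*} (Γ : BrauerGraph V E H)

/-! ### Turning around a vertex -/

/-- The number of half-edges at the vertex of `h`. -/
abbrev valency (h : H) : ℕ := Function.minimalPeriod Γ.succ h

theorem valency_pos (h : H) : 0 < Γ.valency h := by
  have := Γ.finite
  exact Function.minimalPeriod_pos_of_mem_periodicPts
    (Function.Injective.mem_periodicPts Γ.succ.injective h)

theorem iterate_valency (h : H) : Γ.succ^[Γ.valency h] h = h :=
  Function.iterate_minimalPeriod

theorem valency_iterate (h : H) (n : ℕ) : Γ.valency (Γ.succ^[n] h) = Γ.valency h := by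
  have := Γ.finite
  exact Function.minimalPeriod_apply_iterate
    (Function.Injective.mem_periodicPts Γ.succ.injective h) n

theorem valency_succ (h : H) : Γ.valency (Γ.succ h) = Γ.valency h :=
  Γ.valency_iterate h 1

theorem iterate_valency_sub_one (h : H) : Γ.succ^[Γ.valency h - 1] (Γ.succ h) = h := by
  rw [← Function.iterate_succ_apply, Nat.succ_eq_add_one, Nat.sub_add_cancel (Γ.valency_pos h),
    Γ.iterate_valency]

/-- A set of half-edges with exactly one element at every vertex. -/
structure IsCutAt (L : H → Prop) : Prop where
  exists_iterate : ∀ h, ∃ n, L (Γ.succ^[n] h)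
  iterate_eq : ∀ h n, L h → L (Γ.succ^[n] h) → Γ.succ^[n] h = h

namespace IsCutAt

variable {Γ} {L : H → Prop} (hL : Γ.IsCutAt L)

open Classical in
/-- The number of steps from a half-edge to the distinguished half-edge at its vertex. -/
def dist (h : H) : ℕ := Nat.find (hL.exists_iterate h)

theorem iterate_dist (h : H) : L (Γ.succ^[hL.dist h] h) := by
  classical
  exact Nat.find_spec (hL.exists_iterate h)

theorem not_of_lt_dist {h : H} {n : ℕ} (hn : n < hL.dist h) : ¬ L (Γ.succ^[n] h) := by
  classical
  exact Nat.find_min (hL.exists_iterate h) hn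

theorem dist_le {h : H} {n : ℕ} (hn : L (Γ.succ^[n] h)) : hL.dist h ≤ n := by
  classical
  exact Nat.find_min' (hL.exists_iterate h) hn

theorem dist_lt_valency (h : H) : hL.dist h < Γ.valency h := by
  have h1 := hL.iterate_dist h
  have h2 : Γ.succ^[hL.dist h % Γ.valency h] h = Γ.succ^[hL.dist h] h :=
    Function.iterate_mod_minimalPeriod_eq
  rw [← h2] at h1
  exact (hL.dist_le h1).trans_lt (Nat.mod_lt _ (Γ.valency_pos h))

theorem dist_succ {h : H} (h' : ¬ L h) : hL.dist h = hL.dist (Γ.succ h) + 1 := by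
  apply le_antisymm
  · exact hL.dist_le (hL.iterate_dist (Γ.succ h))
  · have h0 : hL.dist h ≠ 0 := fun h0 => h' (by simpa [h0] using hL.iterate_dist h)
    obtain ⟨m, hm⟩ := Nat.exists_eq_succ_of_ne_zero h0
    rw [hm]
    refine Nat.succ_le_succ (hL.dist_le ?_)
    have := hL.iterate_dist h
    rwa [hm] at this

theorem dist_eq_zero {h : H} (h' : L h) : hL.dist h = 0 :=
  Nat.le_zero.mp (hL.dist_le (n := 0) h')

theorem dist_iterate {h : H} {n : ℕ} (hn : n ≤ hL.dist h) :
    hL.dist (Γ.succ^[n] h) = hL.dist h - n := by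
  induction n with
  | zero => rfl
  | succ n ih =>
    have h1 := hL.dist_succ (hL.not_of_lt_dist (Nat.lt_of_succ_le hn))
    rw [ih (by omega)] at h1
    rw [Function.iterate_succ_apply']
    omega

/-- After the distinguished half-edge, no distinguished one comes before a full turn. -/
theorem not_iterate_succ (hL : Γ.IsCutAt L) {g : H} (hg : L g) {n : ℕ} (hn : n + 1 < Γ.valency g) :
    ¬ L (Γ.succ^[n] (Γ.succ g)) := by
  intro h
  have h1 := hL.iterate_eq g (n + 1) hg h
  have h2 : Γ.valency g ≤ n + 1 :=
    Function.IsPeriodicPt.minimalPeriod_le (Nat.succ_pos n) h1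
  omega

theorem dist_succ_of {g : H} (hg : L g) : hL.dist (Γ.succ g) = Γ.valency g - 1 := by
  apply le_antisymm
  · apply hL.dist_le
    rw [Γ.iterate_valency_sub_one]
    exact hg
  · by_contra! h
    exact hL.not_iterate_succ hg (by omega) (hL.iterate_dist (Γ.succ g))

theorem dist_iterate_of_lt {h : H} {n : ℕ} (hn : hL.dist h < n) (hn' : n ≤ Γ.valency h) :
    hL.dist (Γ.succ^[n] h) = hL.dist h + Γ.valency h - n := by
  set g := Γ.succ^[hL.dist h] h with hg
  have h1 : Γ.succ^[n] h = Γ.succ^[n - hL.dist h - 1] (Γ.succ g) := by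
    rw [hg, ← Function.iterate_succ_apply, ← Function.iterate_add_apply]
    congr 1
    omega
  have hLg : L g := hL.iterate_dist h
  have h2 := hL.dist_succ_of hLg
  have h3 : Γ.valency g = Γ.valency h := Γ.valency_iterate h _
  rw [h1, hL.dist_iterate (by omega)]
  have := hL.dist_lt_valency h
  omega

end IsCutAt

/-! ### Words of consecutive arrows -/

section Word

variable {A : Type*} [Ring A] (e : E → A) (a : H → A)

/-- The product of the `n` consecutive elements `a h`, `a (succ h)`, … around the vertex of `h`,
followed by the idempotent of the edge that is reached. -/
def word : H → ℕ → A
  | h, 0 => e (Γ.edge h)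
  | h, n + 1 => a h * word (Γ.succ h) n

variable {Γ e a} in
theorem map_word {B : Type*} [Ring B] (f : A →+* B) (h : H) (n : ℕ) :
    f (Γ.word e a h n) = Γ.word (fun i => f (e i)) (fun h => f (a h)) h n := by
  induction n generalizing h with
  | zero => rfl
  | succ n ih => rw [word, word, map_mul, ih]

variable [Fintype E]

/-- The relations between trivial paths and arrows that all the algebras here share. -/
structure IsArrowSystem : Prop where
  idem_mul_idem : ∀ i, e i * e i = e i
  idem_mul_idem_of_ne : ∀ i j, i ≠ j → e i * e j = 0
  sum_idem : ∑ i, e i = 1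
  idem_mul : ∀ h, e (Γ.edge h) * a h = a h
  mul_idem : ∀ h, a h * e (Γ.edge (Γ.succ h)) = a h
  mul_eq_zero : ∀ h h', h' ≠ Γ.succ h → a h * a h' = 0

variable {Γ e a}

theorem IsArrowSystem.idem_mul_of_ne (hs : Γ.IsArrowSystem e a) {i : E} {h : H}
    (hi : i ≠ Γ.edge h) : e i * a h = 0 := by
  rw [← hs.idem_mul h, ← mul_assoc, hs.idem_mul_idem_of_ne _ _ hi, zero_mul]

theorem IsArrowSystem.mul_idem_of_ne (hs : Γ.IsArrowSystem e a) {i : E} {h : H}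
    (hi : Γ.edge (Γ.succ h) ≠ i) : a h * e i = 0 := by
  rw [← hs.mul_idem h, mul_assoc, hs.idem_mul_idem_of_ne _ _ hi, mul_zero]

theorem IsArrowSystem.idem_mul_word (hs : Γ.IsArrowSystem e a) (h : H) (n : ℕ) :
    e (Γ.edge h) * Γ.word e a h n = Γ.word e a h n := by
  cases n with
  | zero => exact hs.idem_mul_idem _
  | succ n => rw [word, ← mul_assoc, hs.idem_mul]

theorem IsArrowSystem.word_one (hs : Γ.IsArrowSystem e a) (h : H) : Γ.word e a h 1 = a h :=
  hs.mul_idem h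

theorem IsArrowSystem.word_add (hs : Γ.IsArrowSystem e a) (h : H) (n m : ℕ) :
    Γ.word e a h (n + m) = Γ.word e a h n * Γ.word e a (Γ.succ^[n] h) m := by
  induction n generalizing h with
  | zero =>
    rw [Nat.zero_add, word, Function.iterate_zero_apply, hs.idem_mul_word]
  | succ n ih =>
    rw [Nat.succ_add, word, word, ih, mul_assoc, Function.iterate_succ_apply]

theorem IsArrowSystem.word_succ (hs : Γ.IsArrowSystem e a) (h : H) (n : ℕ) :
    Γ.word e a h (n + 1) = Γ.word e a h n * a (Γ.succ^[n] h) := by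
  rw [hs.word_add, hs.word_one]

theorem IsArrowSystem.word_mul_idem (hs : Γ.IsArrowSystem e a) (h : H) (n : ℕ) :
    Γ.word e a h n * e (Γ.edge (Γ.succ^[n] h)) = Γ.word e a h n :=
  (hs.word_add h n 0).symm

theorem IsArrowSystem.word_mul_idem_of_ne (hs : Γ.IsArrowSystem e a) {h : H} {n : ℕ} {i : E}
    (hi : Γ.edge (Γ.succ^[n] h) ≠ i) : Γ.word e a h n * e i = 0 := by
  rw [← hs.word_mul_idem h n, mul_assoc, hs.idem_mul_idem_of_ne _ _ hi, mul_zero]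

theorem IsArrowSystem.word_mul_of_ne (hs : Γ.IsArrowSystem e a) {h g : H} {n : ℕ}
    (hg : g ≠ Γ.succ^[n + 1] h) : Γ.word e a h (n + 1) * a g = 0 := by
  rw [Function.iterate_succ_apply'] at hg
  rw [hs.word_succ, mul_assoc, hs.mul_eq_zero _ _ hg, mul_zero]

theorem IsArrowSystem.mul_word_of_ne (hs : Γ.IsArrowSystem e a) {h g : H} {n : ℕ}
    (hg : g ≠ Γ.succ h) : a h * Γ.word e a g (n + 1) = 0 := by
  rw [word, ← mul_assoc, hs.mul_eq_zero _ _ hg, zero_mul]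

theorem IsArrowSystem.word_sub_one_mul (hs : Γ.IsArrowSystem e a) (h : H) :
    Γ.word e a h (Γ.valency h)
      = Γ.word e a h (Γ.valency h - 1) * a (Γ.succ^[Γ.valency h - 1] h) := by
  rw [← hs.word_succ, Nat.sub_add_cancel (Γ.valency_pos h)]

/-- The words span an algebra that is generated by trivial paths and arrows. -/
theorem IsArrowSystem.span_word {k : Type*} [Field k] [Algebra k A] (hs : Γ.IsArrowSystem e a)
    (hgen : ∀ U : Submodule k A, 1 ∈ U → (∀ i, ∀ u ∈ U, e i * u ∈ U) →
      (∀ h, ∀ u ∈ U, a h * u ∈ U) → U = ⊤) :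
    Submodule.span k (Set.range fun p : H × ℕ => Γ.word e a p.1 p.2) = ⊤ := by
  have hmem : ∀ h n, Γ.word e a h n ∈
      Submodule.span k (Set.range fun p : H × ℕ => Γ.word e a p.1 p.2) :=
    fun h n => Submodule.subset_span ⟨(h, n), rfl⟩
  have hidem : ∀ i, e i ∈ Submodule.span k (Set.range fun p : H × ℕ => Γ.word e a p.1 p.2) := by
    intro i
    obtain ⟨h, rfl⟩ := Γ.edge_surjective i
    exact hmem h 0
  apply hgen
  · rw [← hs.sum_idem]
    exact Submodule.sum_mem _ fun i _ => hidem i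
  · intro i u hu
    induction hu using Submodule.span_induction with
    | mem u hu =>
      obtain ⟨⟨h, n⟩, rfl⟩ := hu
      dsimp only
      by_cases hi : i = Γ.edge h
      · rw [hi, hs.idem_mul_word]
        exact hmem h n
      · rw [← hs.idem_mul_word, ← mul_assoc, hs.idem_mul_idem_of_ne _ _ hi, zero_mul]
        exact Submodule.zero_mem _
    | zero => rw [mul_zero]; exact Submodule.zero_mem _
    | add x y _ _ hx hy => rw [mul_add]; exact Submodule.add_mem _ hx hy
    | smul r x _ hx => rw [mul_smul_comm]; exact Submodule.smul_mem _ _ hx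
  · intro g u hu
    induction hu using Submodule.span_induction with
    | mem u hu =>
      obtain ⟨⟨h, n⟩, rfl⟩ := hu
      dsimp only
      cases n with
      | zero =>
        rw [word]
        by_cases hi : Γ.edge (Γ.succ g) = Γ.edge h
        · rw [← hi, hs.mul_idem, ← hs.word_one]
          exact hmem g 1
        · rw [hs.mul_idem_of_ne hi]
          exact Submodule.zero_mem _
      | succ n =>
        by_cases hg : h = Γ.succ g
        · subst hg
          exact hmem g (n + 2)
        · rw [hs.mul_word_of_ne hg]
          exact Submodule.zero_mem _
    | zero => rw [mul_zero]; exact Submodule.zero_mem _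
    | add x y _ _ hx hy => rw [mul_add]; exact Submodule.add_mem _ hx hy
    | smul r x _ hx => rw [mul_smul_comm]; exact Submodule.smul_mem _ _ hx

end Word

end BrauerGraph

namespace BrauerGraph

variable {V E H : Type*} (Γ : BrauerGraph V E H)

/-! ### The action of an algebra of arrows on formal paths -/

/-- The formal path of length `n` that starts at `h`: a trivial path if `n = 0`. -/
def formalPath : H → ℕ → E ⊕ H × ℕ
  | h, 0 => Sum.inl (Γ.edge h)
  | h, n + 1 => Sum.inr (h, n)

theorem formalPath_zero_opp (h : H) : Γ.formalPath (Γ.opp h) 0 = Γ.formalPath h 0 :=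
  congrArg Sum.inl ((Γ.edge_eq_iff h (Γ.opp h)).mpr (Or.inr rfl)).symm

/-- The edge at which a formal path starts. -/
def formalSource : E ⊕ H × ℕ → E := Sum.elim id fun p => Γ.edge p.1

theorem formalSource_formalPath (h : H) (n : ℕ) : Γ.formalSource (Γ.formalPath h n) = Γ.edge h := by
  cases n <;> rfl

variable (k : Type*) [Field k]

open Classical in
/-- The action of the trivial path `i` on formal linear combinations of formal paths. -/
def idemOp (i : E) : Module.End k (E ⊕ H × ℕ → k) where
  toFun w p := if Γ.formalSource p = i then w p else 0
  map_add' w w' := by ext p; by_cases h : Γ.formalSource p = i <;> simp [h]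
  map_smul' r w := by ext p; by_cases h : Γ.formalSource p = i <;> simp [h]

open Classical in
/-- The action of the arrow of `h` on formal linear combinations of formal paths. -/
def arrowOp (h : H) : Module.End k (E ⊕ H × ℕ → k) where
  toFun w := Sum.elim 0 fun p => if p.1 = h then w (Γ.formalPath (Γ.succ h) p.2) else 0
  map_add' w w' := by
    ext (i | p)
    · simp
    · by_cases hp : p.1 = h <;> simp [hp]
  map_smul' r w := by
    ext (i | p)
    · simp
    · by_cases hp : p.1 = h <;> simp [hp]

open Classical in
theorem idemOp_apply (i : E) (w : E ⊕ H × ℕ → k) (p : E ⊕ H × ℕ) :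
    Γ.idemOp k i w p = if Γ.formalSource p = i then w p else 0 := rfl

theorem arrowOp_inl (h : H) (w : E ⊕ H × ℕ → k) (i : E) : Γ.arrowOp k h w (Sum.inl i) = 0 := rfl

open Classical in
theorem arrowOp_inr (h g : H) (n : ℕ) (w : E ⊕ H × ℕ → k) :
    Γ.arrowOp k h w (Sum.inr (g, n))
      = if g = h then w (Γ.formalPath (Γ.succ h) n) else 0 := rfl

theorem isArrowSystem_op [Fintype E] : Γ.IsArrowSystem (Γ.idemOp k) (Γ.arrowOp k) where
  idem_mul_idem i := by
    ext1 w
    funext p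
    simp only [Module.End.mul_apply, idemOp_apply]
    split_ifs <;> rfl
  idem_mul_idem_of_ne i j hij := by
    ext1 w
    funext p
    simp only [Module.End.mul_apply, idemOp_apply]
    split_ifs with h h'
    · exact absurd (h.symm.trans h') hij
    · rfl
    · rfl
  sum_idem := by
    ext1 w
    funext p
    rw [LinearMap.sum_apply, Finset.sum_apply]
    simp only [idemOp_apply]
    rw [Finset.sum_eq_single (Γ.formalSource p) (fun i _ hi => if_neg hi.symm) (by simp)]
    exact if_pos rfl
  idem_mul h := by
    ext1 w
    funext p
    rw [Module.End.mul_apply, idemOp_apply]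
    obtain i | ⟨g, n⟩ := p
    · simp [arrowOp_inl]
    · rw [arrowOp_inr]
      by_cases hg : g = h
      · subst hg
        exact if_pos rfl
      · simp [hg]
  mul_idem h := by
    ext1 w
    funext p
    rw [Module.End.mul_apply]
    obtain i | ⟨g, n⟩ := p
    · rfl
    · rw [arrowOp_inr, arrowOp_inr, idemOp_apply, formalSource_formalPath, if_pos rfl]
  mul_eq_zero h h' hh := by
    ext1 w
    funext p
    rw [Module.End.mul_apply]
    obtain i | ⟨g, n⟩ := p
    · rfl
    · rw [arrowOp_inr]
      cases n with
      | zero => simp [formalPath, arrowOp_inl]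
      | succ n => simp [formalPath, arrowOp_inr, hh.symm]

variable {Γ k}

/-- An algebra that is generated by trivial paths and the arrows at half-edges not in `L`, in which
the product of two arrows is zero if they are not consecutive around a vertex, and in which all
other paths are linearly independent, as they act independently on formal paths. -/
structure IsCutAlgebra [Fintype E] (L : H → Prop) {A : Type*} [Ring A] [Algebra k A] (e : E → A)
    (a : H → A) (ρ : A →ₐ[k] Module.End k (E ⊕ H × ℕ → k)) : Prop
    extends Γ.IsArrowSystem e a where
  cut : Γ.IsCutAt L
  eq_zero : ∀ h, L h → a h = 0
  generate : ∀ U : Submodule k A, 1 ∈ U → (∀ i, ∀ u ∈ U, e i * u ∈ U) →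
      (∀ h, ∀ u ∈ U, a h * u ∈ U) → U = ⊤
  map_idem : ∀ i, ρ (e i) = Γ.idemOp k i
  map_arrow : ∀ h, ¬ L h → ρ (a h) = Γ.arrowOp k h

/-- The formal linear combination that represents the unit. -/
def formalOne : E ⊕ H × ℕ → k := Sum.elim 1 0

/-- The coefficient of a formal path in an element of an algebra that acts on formal paths. -/
def coeff {A : Type*} [Ring A] [Algebra k A] (ρ : A →ₐ[k] Module.End k (E ⊕ H × ℕ → k))
    (p : E ⊕ H × ℕ) : DualBimodule k A :=
  (LinearMap.proj p ∘ₗ LinearMap.applyₗ (formalOne : E ⊕ H × ℕ → k) ∘ₗ ρ.toLinearMap : A →ₗ[k] k)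

theorem coeff_apply {A : Type*} [Ring A] [Algebra k A] (ρ : A →ₐ[k] Module.End k (E ⊕ H × ℕ → k))
    (p : E ⊕ H × ℕ) (x : A) : coeff ρ p x = ρ x formalOne p := rfl

namespace IsCutAlgebra

variable [Fintype E] {L : H → Prop} {A : Type*} [Ring A] [Algebra k A] {e : E → A}
    {a : H → A} {ρ : A →ₐ[k] Module.End k (E ⊕ H × ℕ → k)} (hA : Γ.IsCutAlgebra L e a ρ)

section
include hA

theorem coeff_arrow_mul {h : H} (hh : ¬ L h) (n : ℕ) (x : A) :
    coeff ρ (Γ.formalPath h (n + 1)) (a h * x) = coeff ρ (Γ.formalPath (Γ.succ h) n) x := by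
  rw [coeff_apply, map_mul, Module.End.mul_apply, hA.map_arrow h hh, formalPath, arrowOp_inr,
    if_pos rfl, coeff_apply]

theorem coeff_zero_arrow_mul (h g : H) (x : A) : coeff ρ (Γ.formalPath h 0) (a g * x) = 0 := by
  by_cases hg : L g
  · rw [hA.eq_zero g hg, zero_mul, map_zero]
  · rw [coeff_apply, map_mul, Module.End.mul_apply, hA.map_arrow g hg, formalPath, arrowOp_inl]

theorem coeff_arrow_mul_of_ne {h g : H} (hg : g ≠ h) (n : ℕ) (x : A) :
    coeff ρ (Γ.formalPath h n) (a g * x) = 0 := by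
  cases n with
  | zero => exact hA.coeff_zero_arrow_mul h g x
  | succ n =>
    by_cases hg' : L g
    · rw [hA.eq_zero g hg', zero_mul, map_zero]
    · rw [coeff_apply, map_mul, Module.End.mul_apply, hA.map_arrow g hg', formalPath, arrowOp_inr,
        if_neg hg.symm]

theorem coeff_idem_mul (h : H) (n : ℕ) (x : A) :
    coeff ρ (Γ.formalPath h n) (e (Γ.edge h) * x) = coeff ρ (Γ.formalPath h n) x := by
  rw [coeff_apply, map_mul, Module.End.mul_apply, hA.map_idem, idemOp_apply,
    formalSource_formalPath, if_pos rfl, coeff_apply]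

theorem word_eq_zero {h : H} {n : ℕ} (hn : hA.cut.dist h < n) : Γ.word e a h n = 0 := by
  obtain ⟨m, rfl⟩ := Nat.exists_eq_add_of_lt hn
  rw [add_assoc, add_comm m, ← add_assoc, hA.word_add, hA.word_succ,
    hA.eq_zero _ (hA.cut.iterate_dist h), mul_zero, zero_mul]

open Classical in
theorem coeff_word {h : H} {n : ℕ} (hn : n ≤ hA.cut.dist h) (p : E ⊕ H × ℕ) :
    coeff ρ p (Γ.word e a h n) = if p = Γ.formalPath h n then 1 else 0 := by
  induction n generalizing h p with
  | zero =>
    rw [coeff_apply, word, hA.map_idem, idemOp_apply]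
    obtain i | p := p
    · exact if_congr (by simp [formalSource, formalPath]) rfl rfl
    · exact (ite_self (0 : k)).trans (if_neg (by simp [formalPath])).symm
  | succ n ih =>
    have hh : ¬ L h := fun hh => by
      rw [hA.cut.dist_eq_zero hh] at hn
      omega
    have h1 := hA.cut.dist_succ hh
    obtain i | ⟨g, m⟩ := p
    · rw [word, coeff_apply, map_mul, Module.End.mul_apply, hA.map_arrow h hh, arrowOp_inl]
      simp [formalPath]
    · by_cases hg : g = h
      · subst hg
        have h2 : Γ.formalPath (Γ.succ g) m = Γ.formalPath (Γ.succ g) n ↔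
            (Sum.inr (g, m) : E ⊕ H × ℕ) = Γ.formalPath g (n + 1) := by
          cases m <;> cases n <;> simp [formalPath]
        exact (hA.coeff_arrow_mul hh m _).trans ((ih (by omega) _).trans (by simp only [h2]))
      · refine (hA.coeff_arrow_mul_of_ne (h := g) (Ne.symm hg) (m + 1) _).trans ?_
        simp [formalPath, hg]

theorem dual_ext {f g : DualBimodule k A}
    (hfg : ∀ h n, n ≤ hA.cut.dist h → f (Γ.word e a h n) = g (Γ.word e a h n)) : f = g := by
  refine LinearMap.ext_on (M := A) (M₂ := k)
    (hA.span_word hA.generate) ?_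
  rintro _ ⟨⟨h, n⟩, rfl⟩
  by_cases hn : n ≤ hA.cut.dist h
  · exact hfg h n hn
  · dsimp only
    rw [hA.word_eq_zero (not_le.mp hn)]
    exact (map_zero f).trans (map_zero g).symm

theorem coeff_mul_arrow {h : H} {n : ℕ} (hn : n < hA.cut.dist h) (x : A) :
    coeff ρ (Γ.formalPath h (n + 1)) (x * a (Γ.succ^[n] h)) = coeff ρ (Γ.formalPath h n) x := by
  have hg : ¬ L (Γ.succ^[n] h) := hA.cut.not_of_lt_dist hn
  revert x
  suffices hfg : a (Γ.succ^[n] h) • coeff ρ (Γ.formalPath h (n + 1)) = coeff ρ (Γ.formalPath h n)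
    from fun x => DFunLike.congr_fun hfg x
  refine hA.dual_ext fun h' m hm => ?_
  rw [DualBimodule.smul_apply, hA.coeff_word hm]
  cases m with
  | zero =>
    rw [word]
    by_cases he : Γ.edge h' = Γ.edge (Γ.succ^[n] h)
    · rw [he, hA.idem_mul, ← hA.word_one, hA.coeff_word]
      · cases n <;> simp [formalPath, he]
      · rw [hA.cut.dist_succ hg]
        omega
    · rw [hA.idem_mul_of_ne he, map_zero]
      cases n with
      | zero =>
        rw [Function.iterate_zero_apply] at he
        simp [formalPath, Ne.symm he]
      | succ n => simp [formalPath]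
  | succ m =>
    by_cases hw : Γ.succ^[n] h = Γ.succ^[m + 1] h'
    · by_cases hm' : m + 2 ≤ hA.cut.dist h'
      · rw [hw, ← hA.word_succ, hA.coeff_word hm']
        have hp : Γ.formalPath h (n + 1) = Γ.formalPath h' (m + 1 + 1) ↔
            Γ.formalPath h n = Γ.formalPath h' (m + 1) := by
          cases n <;> simp [formalPath]
        by_cases hp' : Γ.formalPath h n = Γ.formalPath h' (m + 1)
        · rw [if_pos hp', if_pos (hp.mpr hp')]
        · rw [if_neg hp', if_neg fun hq => hp' (hp.mp hq)]
      · rw [hw, ← hA.word_succ, hA.word_eq_zero (by omega), map_zero, if_neg]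
        intro hp
        cases n with
        | zero => simp [formalPath] at hp
        | succ n =>
          simp only [formalPath, Sum.inr.injEq, Prod.mk.injEq] at hp
          obtain ⟨rfl, rfl⟩ := hp
          omega
    · rw [hA.word_mul_of_ne hw, map_zero, if_neg]
      intro hp
      cases n with
      | zero => simp [formalPath] at hp
      | succ n =>
        simp only [formalPath, Sum.inr.injEq, Prod.mk.injEq] at hp
        obtain ⟨rfl, rfl⟩ := hp
        exact hw rfl

theorem coeff_zero_mul_arrow (h g : H) (x : A) : coeff ρ (Γ.formalPath h 0) (x * a g) = 0 := by
  revert x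
  suffices hfg : a g • coeff ρ (Γ.formalPath h 0) = 0 from fun x => DFunLike.congr_fun hfg x
  refine hA.dual_ext fun h' m _ => ?_
  rw [DualBimodule.smul_apply]
  refine Eq.trans ?_ (LinearMap.zero_apply (M := A) (M₂ := k) (σ₁₂ := RingHom.id k) _).symm
  cases m with
  | zero =>
    rw [word]
    by_cases he : Γ.edge h' = Γ.edge g
    · rw [he, hA.idem_mul, ← mul_one (a g), hA.coeff_zero_arrow_mul]
    · rw [hA.idem_mul_of_ne he, map_zero]
  | succ m => rw [word, mul_assoc, hA.coeff_zero_arrow_mul]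

theorem coeff_mul_arrow_of_ne {h g : H} {n : ℕ} (hg : g ≠ Γ.succ^[n] h) (x : A) :
    coeff ρ (Γ.formalPath h (n + 1)) (x * a g) = 0 := by
  revert x
  suffices hfg : a g • coeff ρ (Γ.formalPath h (n + 1)) = 0 from fun x => DFunLike.congr_fun hfg x
  refine hA.dual_ext fun h' m _ => ?_
  rw [DualBimodule.smul_apply]
  refine Eq.trans ?_ (LinearMap.zero_apply (M := A) (M₂ := k) (σ₁₂ := RingHom.id k) _).symm
  by_cases hL : L g
  · rw [hA.eq_zero g hL, mul_zero, map_zero]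
  cases m with
  | zero =>
    rw [word]
    by_cases he : Γ.edge h' = Γ.edge g
    · rw [he, hA.idem_mul, ← hA.word_one, hA.coeff_word (by rw [hA.cut.dist_succ hL]; omega), if_neg]
      intro hp
      simp only [formalPath, Sum.inr.injEq, Prod.mk.injEq] at hp
      obtain ⟨rfl, rfl⟩ := hp
      exact hg rfl
    · rw [hA.idem_mul_of_ne he, map_zero]
  | succ m =>
    by_cases hw : g = Γ.succ^[m + 1] h'
    · rw [hw, ← hA.word_succ]
      by_cases hm' : m + 2 ≤ hA.cut.dist h'
      · rw [hA.coeff_word hm', if_neg]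
        intro hp
        simp only [formalPath, Sum.inr.injEq, Prod.mk.injEq] at hp
        obtain ⟨rfl, rfl⟩ := hp
        exact hg hw
      · rw [hA.word_eq_zero (by omega), map_zero]
    · rw [hA.word_mul_of_ne hw, map_zero]

theorem coeff_mul_idem {h : H} {n : ℕ} (hn : n ≤ hA.cut.dist h) (x : A) :
    coeff ρ (Γ.formalPath h n) (x * e (Γ.edge (Γ.succ^[n] h))) = coeff ρ (Γ.formalPath h n) x := by
  revert x
  suffices hfg : e (Γ.edge (Γ.succ^[n] h)) • coeff ρ (Γ.formalPath h n)
      = coeff ρ (Γ.formalPath h n) from fun x => DFunLike.congr_fun hfg x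
  refine hA.dual_ext fun h' m hm => ?_
  rw [DualBimodule.smul_apply]
  by_cases he : Γ.edge (Γ.succ^[m] h') = Γ.edge (Γ.succ^[n] h)
  · rw [← he, hA.word_mul_idem]
  · rw [hA.word_mul_idem_of_ne he, map_zero, hA.coeff_word hm, if_neg]
    intro hp
    cases n <;> cases m <;> simp_all [formalPath]

end

end IsCutAlgebra

end BrauerGraph

namespace BrauerGraph

variable {V E H : Type*} {Γ : BrauerGraph V E H} {k : Type*} [Field k]

/-! ### Arrows in the trivial extension -/

namespace IsCutAlgebra

variable {L : H → Prop} {A : Type*} [Ring A] [Algebra k A] {e : E → A}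
    {a : H → A} {ρ : A →ₐ[k] Module.End k (E ⊕ H × ℕ → k)}

variable (Γ L a ρ) in
open Classical in
/-- The arrow at `h` in the trivial extension: if `h` is in `L`, then it is dual to the longest path
around the vertex of `h`. -/
def extArrow (h : H) : TrivialExtension k A :=
  if L h then TrivSqZeroExt.inr (coeff ρ (Γ.formalPath (Γ.succ h) (Γ.valency h - 1)))
  else TrivSqZeroExt.inl (a h)

theorem extArrow_of {h : H} (hh : L h) : extArrow Γ L a ρ h
    = TrivSqZeroExt.inr (coeff ρ (Γ.formalPath (Γ.succ h) (Γ.valency h - 1))) := if_pos hh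

theorem extArrow_of_not {h : H} (hh : ¬ L h) :
    extArrow Γ L a ρ h = TrivSqZeroExt.inl (a h) := if_neg hh

variable (k e) in
/-- The trivial paths in the trivial extension. -/
def extIdem (i : E) : TrivialExtension k A := TrivSqZeroExt.inl (e i)

section
variable [Fintype E] (hA : Γ.IsCutAlgebra L e a ρ)
include hA

theorem isArrowSystem_ext : Γ.IsArrowSystem (extIdem k e) (extArrow Γ L a ρ) where
  idem_mul_idem i := by
    rw [extIdem, TrivSqZeroExt.inl_mul_inl, hA.idem_mul_idem]
  idem_mul_idem_of_ne i j hij := by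
    rw [extIdem, extIdem, TrivSqZeroExt.inl_mul_inl, hA.idem_mul_idem_of_ne _ _ hij,
      TrivSqZeroExt.inl_zero]
  sum_idem := by
    rw [← TrivSqZeroExt.inl_one, ← hA.sum_idem]
    exact (map_sum (TrivSqZeroExt.inlHom A (DualBimodule k A)) e Finset.univ).symm
  idem_mul h := by
    by_cases hh : L h
    · rw [extArrow_of hh, extIdem, TrivSqZeroExt.inl_mul_inr]
      congr 1
      refine DFunLike.ext _ _ fun x => ?_
      rw [DualBimodule.smul_apply]
      have h1 := hA.coeff_mul_idem (h := Γ.succ h) (n := Γ.valency h - 1)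
        (hA.cut.dist_succ_of hh).ge x
      rwa [Γ.iterate_valency_sub_one] at h1
    · rw [extArrow_of_not hh, extIdem, TrivSqZeroExt.inl_mul_inl, hA.idem_mul]
  mul_idem h := by
    by_cases hh : L h
    · rw [extArrow_of hh, extIdem, TrivSqZeroExt.inr_mul_inl]
      congr 1
      refine DFunLike.ext _ _ fun x => ?_
      rw [DualBimodule.op_smul_apply, hA.coeff_idem_mul]
    · rw [extArrow_of_not hh, extIdem, TrivSqZeroExt.inl_mul_inl, hA.mul_idem]
  mul_eq_zero h h' hne := by
    by_cases hh : L h <;> by_cases hh' : L h'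
    · rw [extArrow_of hh, extArrow_of hh', TrivSqZeroExt.inr_mul_inr]
    · rw [extArrow_of hh, extArrow_of_not hh', TrivSqZeroExt.inr_mul_inl,
        ← TrivSqZeroExt.inr_zero A]
      congr 1
      refine DFunLike.ext _ _ fun x => ?_
      rw [DualBimodule.op_smul_apply, hA.coeff_arrow_mul_of_ne hne]
      rfl
    · rw [extArrow_of_not hh, extArrow_of hh', TrivSqZeroExt.inl_mul_inr,
        ← TrivSqZeroExt.inr_zero A]
      congr 1
      refine DFunLike.ext _ _ fun x => ?_
      rw [DualBimodule.smul_apply]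
      refine Eq.trans ?_ (LinearMap.zero_apply (M := A) (M₂ := k) (σ₁₂ := RingHom.id k) _).symm
      have h1 := Γ.iterate_valency_sub_one h'
      revert h1
      generalize Γ.valency h' - 1 = n
      intro h1
      cases n with
      | zero => exact hA.coeff_zero_mul_arrow _ _ _
      | succ n =>
        refine hA.coeff_mul_arrow_of_ne ?_ _
        rintro rfl
        rw [Function.iterate_succ_apply'] at h1
        exact hne h1.symm
    · rw [extArrow_of_not hh, extArrow_of_not hh', TrivSqZeroExt.inl_mul_inl,
        hA.mul_eq_zero _ _ hne, TrivSqZeroExt.inl_zero]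

theorem ext_word {h : H} {n : ℕ} (hn : n ≤ hA.cut.dist h) :
    Γ.word (extIdem k e) (extArrow Γ L a ρ) h n = TrivSqZeroExt.inl (Γ.word e a h n) := by
  induction n with
  | zero => rfl
  | succ n ih =>
    rw [hA.isArrowSystem_ext.word_succ, ih (by omega), hA.word_succ,
      extArrow_of_not (hA.cut.not_of_lt_dist (Nat.lt_of_succ_le hn)), TrivSqZeroExt.inl_mul_inl]

theorem ext_word_of {g : H} (hg : L g) {j : ℕ} (hj : j < Γ.valency g) :
    Γ.word (extIdem k e) (extArrow Γ L a ρ) g (j + 1)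
      = TrivSqZeroExt.inr
        (coeff ρ (Γ.formalPath (Γ.succ^[j + 1] g) (Γ.valency g - 1 - j))) := by
  induction j with
  | zero => rw [hA.isArrowSystem_ext.word_one, extArrow_of hg]; rfl
  | succ j ih =>
    have h1 : ¬ L (Γ.succ^[j + 1] g) := hA.cut.not_iterate_succ hg hj
    rw [hA.isArrowSystem_ext.word_succ, ih (by omega), extArrow_of_not h1,
      TrivSqZeroExt.inr_mul_inl]
    congr 1
    refine DFunLike.ext _ _ fun x => ?_
    rw [DualBimodule.op_smul_apply]
    have h2 : Γ.valency g - 1 - j = Γ.valency g - 1 - (j + 1) + 1 := by omega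
    rw [h2, hA.coeff_arrow_mul h1, Function.iterate_succ_apply' _ (j + 1)]

/-- A word that passes through `L` is dual to the complementary word. -/
theorem ext_word_compl {h : H} {n : ℕ} (hn : n ≤ hA.cut.dist h) :
    Γ.word (extIdem k e) (extArrow Γ L a ρ) (Γ.succ^[n] h) (Γ.valency h - n)
      = TrivSqZeroExt.inr (coeff ρ (Γ.formalPath h n)) := by
  have hd := hA.cut.dist_lt_valency h
  induction hm : hA.cut.dist h - n generalizing n with
  | zero =>
    obtain rfl : n = hA.cut.dist h := by omega
    have h1 := hA.ext_word_of (hA.cut.iterate_dist h) (j := Γ.valency h - hA.cut.dist h - 1)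
      (by rw [Γ.valency_iterate]; omega)
    rw [Γ.valency_iterate, ← Function.iterate_add_apply] at h1
    have h2 : Γ.valency h - hA.cut.dist h - 1 + 1 = Γ.valency h - hA.cut.dist h := by omega
    have h3 : Γ.valency h - 1 - (Γ.valency h - hA.cut.dist h - 1) = hA.cut.dist h := by omega
    rwa [h2, h3, Nat.sub_add_cancel hd.le, Γ.iterate_valency] at h1
  | succ m ih =>
    have h1 := ih (n := n + 1) (by omega) (by omega)
    have h2 : Γ.valency h - n = Γ.valency h - (n + 1) + 1 := by omega
    rw [h2, word, ← Function.iterate_succ_apply' Γ.succ, h1,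
      extArrow_of_not (hA.cut.not_of_lt_dist (by omega)), TrivSqZeroExt.inl_mul_inr]
    congr 1
    refine DFunLike.ext _ _ fun x => ?_
    rw [DualBimodule.smul_apply, hA.coeff_mul_arrow (by omega)]

theorem ext_word_valency (h : H) :
    Γ.word (extIdem k e) (extArrow Γ L a ρ) h (Γ.valency h)
      = TrivSqZeroExt.inr (coeff ρ (Γ.formalPath h 0)) :=
  hA.ext_word_compl (n := 0) (Nat.zero_le _)

theorem ext_word_valency_opp (h : H) :
    Γ.word (extIdem k e) (extArrow Γ L a ρ) (Γ.opp h) (Γ.valency (Γ.opp h))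
      = Γ.word (extIdem k e) (extArrow Γ L a ρ) h (Γ.valency h) := by
  rw [hA.ext_word_valency, hA.ext_word_valency, formalPath_zero_opp]

end

end IsCutAlgebra

end BrauerGraph

namespace BrauerGraph

variable {V E H : Type*} {Γ : BrauerGraph V E H} {k : Type*} [Field k]

/-! ### Algebras in which the two cycles at each edge agree -/

section Cycles

variable {B : Type*} [Ring B] {ε : E → B} {α : H → B}

theorem word_congr {h h' : H} {n n' : ℕ} (hp : Γ.formalPath h n = Γ.formalPath h' n') :
    Γ.word ε α h n = Γ.word ε α h' n' := by
  cases n <;> cases n'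
  · exact congrArg ε (Sum.inl.inj hp)
  · simp [formalPath] at hp
  · simp [formalPath] at hp
  · simp only [formalPath, Sum.inr.injEq, Prod.mk.injEq] at hp
    rw [hp.1, hp.2]

theorem word_compl_congr
    (hopp : ∀ h, Γ.word ε α (Γ.opp h) (Γ.valency (Γ.opp h)) = Γ.word ε α h (Γ.valency h))
    {h h' : H} {n n' : ℕ} (hp : Γ.formalPath h n = Γ.formalPath h' n') :
    Γ.word ε α (Γ.succ^[n] h) (Γ.valency h - n)
      = Γ.word ε α (Γ.succ^[n'] h') (Γ.valency h' - n') := by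
  cases n <;> cases n'
  · obtain rfl | rfl := (Γ.edge_eq_iff h h').mp (Sum.inl.inj hp)
    · rfl
    · exact (hopp h).symm
  · simp [formalPath] at hp
  · simp [formalPath] at hp
  · simp only [formalPath, Sum.inr.injEq, Prod.mk.injEq] at hp
    rw [hp.1, hp.2]

theorem IsArrowSystem.word_valency_mul [Fintype E] (hs : Γ.IsArrowSystem ε α)
    (hopp : ∀ h, Γ.word ε α (Γ.opp h) (Γ.valency (Γ.opp h)) = Γ.word ε α h (Γ.valency h)) (h : H) :
    Γ.word ε α h (Γ.valency h) * α h = 0 := by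
  rw [← hopp, hs.word_sub_one_mul, mul_assoc, hs.mul_eq_zero, mul_zero]
  rw [← Function.iterate_succ_apply' Γ.succ, Nat.succ_eq_add_one,
    Nat.sub_add_cancel (Γ.valency_pos _), Γ.iterate_valency]
  exact (Γ.opp_ne h).symm

theorem IsArrowSystem.word_eq_zero_of_valency_lt [Fintype E] (hs : Γ.IsArrowSystem ε α)
    (hopp : ∀ h, Γ.word ε α (Γ.opp h) (Γ.valency (Γ.opp h)) = Γ.word ε α h (Γ.valency h)) {h : H}
    {n : ℕ} (hn : Γ.valency h < n) : Γ.word ε α h n = 0 := by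
  obtain ⟨m, rfl⟩ := Nat.exists_eq_add_of_lt hn
  rw [add_assoc, add_comm m, ← add_assoc, hs.word_add, hs.word_succ, Γ.iterate_valency,
    hs.word_valency_mul hopp, zero_mul]

end Cycles

namespace IsCutAlgebra

variable [Fintype E] {L : H → Prop} {A : Type*} [Ring A] [Algebra k A] {e : E → A}
    {a : H → A} {ρ : A →ₐ[k] Module.End k (E ⊕ H × ℕ → k)} (hA : Γ.IsCutAlgebra L e a ρ)

/-- The formal paths that do not pass through `L`. -/
def Index (_hA : Γ.IsCutAlgebra L e a ρ) : Type _ :=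
  {q : E ⊕ H × ℕ // ∃ p : H × ℕ, p.2 ≤ _hA.cut.dist p.1 ∧ Γ.formalPath p.1 p.2 = q}

/-- The formal path of length `n` at `h`, if it does not pass through `L`. -/
def index {h : H} {n : ℕ} (hn : n ≤ hA.cut.dist h) : hA.Index :=
  ⟨Γ.formalPath h n, (h, n), hn, rfl⟩

/-- A half-edge and a length that represent a formal path. -/
def rep (q : hA.Index) : H × ℕ := q.2.choose

theorem rep_le (q : hA.Index) : (hA.rep q).2 ≤ hA.cut.dist (hA.rep q).1 := q.2.choose_spec.1

theorem formalPath_rep (q : hA.Index) : Γ.formalPath (hA.rep q).1 (hA.rep q).2 = q.1 :=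
  q.2.choose_spec.2

theorem finite_index : Finite hA.Index := by
  have := Γ.finite
  refine Finite.of_surjective
    (fun p : Σ h : H, Fin (hA.cut.dist h + 1) =>
      (hA.index (Nat.le_of_lt_succ p.2.2) : hA.Index)) ?_
  rintro ⟨_, ⟨h, n⟩, hn, rfl⟩
  exact ⟨⟨h, n, Nat.lt_succ_of_le hn⟩, rfl⟩

open Classical in
theorem coeff_rep (p q : hA.Index) :
    coeff ρ p.1 (Γ.word e a (hA.rep q).1 (hA.rep q).2) = if p = q then 1 else 0 := by
  rw [hA.coeff_word (hA.rep_le q), formalPath_rep]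
  by_cases h : p = q
  · subst h
    simp
  · rw [if_neg h, if_neg fun h' => h (Subtype.ext h')]

/-- The basis of paths. -/
def pathBasis : Module.Basis hA.Index k A :=
  Module.Basis.mk (v := fun q : hA.Index => Γ.word e a (hA.rep q).1 (hA.rep q).2)
    (by
      classical
      rw [linearIndependent_iff']
      intro s g hg p hp
      have h1 := congrArg (coeff ρ p.1) hg
      rw [map_sum, map_zero, Finset.sum_eq_single p] at h1
      · rwa [map_smul, hA.coeff_rep, if_pos rfl, smul_eq_mul, mul_one] at h1
      · intro q _ hq
        rw [map_smul, hA.coeff_rep, if_neg hq.symm, smul_zero]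
      · exact fun h => absurd hp h)
    (by
      rw [← hA.span_word hA.generate, Submodule.span_le]
      rintro _ ⟨⟨h, n⟩, rfl⟩
      by_cases hn : n ≤ hA.cut.dist h
      · refine Submodule.subset_span ⟨hA.index hn, ?_⟩
        exact word_congr (hA.formalPath_rep (hA.index hn))
      · dsimp only
        rw [hA.word_eq_zero (not_le.mp hn)]
        exact Submodule.zero_mem _)

theorem pathBasis_apply (q : hA.Index) :
    hA.pathBasis q = Γ.word e a (hA.rep q).1 (hA.rep q).2 := by
  rw [pathBasis, Module.Basis.mk_apply]

theorem coord_pathBasis (q : hA.Index) : (hA.pathBasis.coord q : DualBimodule k A) = coeff ρ q.1 := by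
  classical
  refine hA.pathBasis.ext (M₁ := k) fun p => ?_
  rw [Module.Basis.coord_apply, Module.Basis.repr_self, Finsupp.single_apply]
  refine Eq.trans ?_ (congrArg (coeff ρ q.1) (hA.pathBasis_apply p).symm)
  rw [hA.coeff_rep]
  by_cases h : p = q
  · rw [if_pos h, if_pos h.symm]
  · rw [if_neg h, if_neg (Ne.symm h)]

/-- The basis of the trivial extension given by the paths and the dual basis. -/
def extBasis : Module.Basis (hA.Index ⊕ hA.Index) k (TrivialExtension k A) :=
  haveI := hA.finite_index
  haveI : DecidableEq hA.Index := Classical.decEq _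
  Module.Basis.prod (M' := DualBimodule k A) hA.pathBasis
    (hA.pathBasis.dualBasis : Module.Basis hA.Index k (A →ₗ[k] k))

theorem extBasis_inl (q : hA.Index) : hA.extBasis (Sum.inl q)
    = TrivSqZeroExt.inl (Γ.word e a (hA.rep q).1 (hA.rep q).2) := by
  rw [← pathBasis_apply]
  exact Prod.ext (Module.Basis.prod_apply_inl_fst _ _ _) (Module.Basis.prod_apply_inl_snd _ _ _)

theorem extBasis_inr (q : hA.Index) : hA.extBasis (Sum.inr q)
    = TrivSqZeroExt.inr (coeff ρ q.1) := by
  have := hA.finite_index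
  rw [← coord_pathBasis]
  refine Prod.ext (Module.Basis.prod_apply_inr_fst _ _ _)
    ((Module.Basis.prod_apply_inr_snd _ _ _).trans ?_)
  let _ : DecidableEq hA.Index := Classical.decEq _
  exact congrFun hA.pathBasis.coe_dualBasis q

include hA in
/-- An algebra that is generated by trivial paths and arrows at all half-edges, in which the two
cycles at each edge agree, is isomorphic to the trivial extension if it maps to it. -/
theorem bijective_of_map {B : Type*} [Ring B] [Algebra k B] {ε : E → B} {α : H → B}
    (hs : Γ.IsArrowSystem ε α)
    (hopp : ∀ h, Γ.word ε α (Γ.opp h) (Γ.valency (Γ.opp h)) = Γ.word ε α h (Γ.valency h))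
    (hgen : ∀ U : Submodule k B, 1 ∈ U → (∀ i, ∀ u ∈ U, ε i * u ∈ U) →
      (∀ h, ∀ u ∈ U, α h * u ∈ U) → U = ⊤)
    (φ : B →ₐ[k] TrivialExtension k A) (hε : ∀ i, φ (ε i) = extIdem k e i)
    (hα : ∀ h, φ (α h) = extArrow Γ L a ρ h) : Function.Bijective φ := by
  have hword : ∀ h n, φ (Γ.word ε α h n) = Γ.word (extIdem k e) (extArrow Γ L a ρ) h n := by
    intro h n
    refine (map_word (φ : B →+* TrivialExtension k A) h n).trans ?_
    congr 1
    · exact funext hε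
    · exact funext hα
  let f : hA.Index ⊕ hA.Index → B := Sum.elim (fun q => Γ.word ε α (hA.rep q).1 (hA.rep q).2)
    fun q => Γ.word ε α (Γ.succ^[(hA.rep q).2] (hA.rep q).1)
      (Γ.valency (hA.rep q).1 - (hA.rep q).2)
  let ψ : TrivialExtension k A →ₗ[k] B := hA.extBasis.constr k f
  have hφψ : ∀ y, φ (ψ y) = y := by
    suffices h : φ.toLinearMap ∘ₗ ψ = LinearMap.id from fun y => LinearMap.congr_fun h y
    refine hA.extBasis.ext fun s => ?_
    have h1 : ψ (hA.extBasis s) = f s := hA.extBasis.constr_basis k f s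
    rw [LinearMap.comp_apply, h1, LinearMap.id_apply]
    obtain q | q := s
    · exact (hword _ _).trans ((hA.ext_word (hA.rep_le q)).trans (hA.extBasis_inl q).symm)
    · refine (hword _ _).trans ((hA.ext_word_compl (hA.rep_le q)).trans ?_)
      rw [extBasis_inr, formalPath_rep]
  have hψ : Function.Surjective ψ := by
    rw [← LinearMap.range_eq_top, Module.Basis.constr_range, eq_top_iff,
      ← hs.span_word hgen, Submodule.span_le]
    have hcompl : ∀ h n, n ≤ hA.cut.dist h → Γ.word ε α (Γ.succ^[n] h) (Γ.valency h - n) ∈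
        Submodule.span k (Set.range f) := fun h n hn =>
      Submodule.subset_span
        ⟨Sum.inr (hA.index hn), word_compl_congr hopp (hA.formalPath_rep (hA.index hn))⟩
    rintro _ ⟨⟨h, n⟩, rfl⟩
    dsimp only
    by_cases hn : n ≤ hA.cut.dist h
    · exact Submodule.subset_span ⟨Sum.inl (hA.index hn),
        word_congr (hA.formalPath_rep (hA.index hn))⟩
    · rw [not_le] at hn
      by_cases hv : Γ.valency h < n
      · rw [hs.word_eq_zero_of_valency_lt hopp hv]
        exact Submodule.zero_mem _
      · rw [not_lt] at hv
        have h1 := hcompl (Γ.succ^[n] h) (Γ.valency h - n)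
          (by rw [hA.cut.dist_iterate_of_lt hn hv]; omega)
        rw [← Function.iterate_add_apply, Γ.valency_iterate, Nat.sub_add_cancel hv,
          Γ.iterate_valency, Nat.sub_sub_self hv] at h1
        exact h1
  refine ⟨fun x y hxy => ?_, fun y => ⟨ψ y, hφψ y⟩⟩
  obtain ⟨x, rfl⟩ := hψ x
  obtain ⟨y, rfl⟩ := hψ y
  rw [hφψ, hφψ] at hxy
  rw [hxy]

end IsCutAlgebra

end BrauerGraph

namespace BrauerGraph

variable {V E H : Type*} {Γ : BrauerGraph V E H} {k : Type*} [Field k]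

/-! ### The Brauer graph algebra -/

theorem edge_opp (h : H) : Γ.edge (Γ.opp h) = Γ.edge h :=
  ((Γ.edge_eq_iff h (Γ.opp h)).mpr (Or.inr rfl)).symm

variable (Γ k) in
/-- The trivial path of an edge. -/
def pathIdem (i : E) : PathAlgebra k Γ.QuiverVertex := PathAlgebra.idem k (V := Γ.QuiverVertex) i

/-- The arrow of a half-edge. -/
def hom {h : H} (hh : ¬ Γ.Truncated h) :
    @Quiver.Hom Γ.QuiverVertex _ (Γ.edge h) (Γ.edge (Γ.succ h)) := ⟨h, hh, rfl, rfl⟩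

theorem arrow_of_truncated {h : H} (hh : Γ.Truncated h) : Γ.arrow k h = 0 := dif_pos hh

theorem arrow_of_not {h : H} (hh : ¬ Γ.Truncated h) :
    Γ.arrow k h = PathAlgebra.ofArrow k (hom hh) := dif_neg hh

theorem idem_mul_arrow (h : H) :
    Γ.pathIdem k (Γ.edge h) * Γ.arrow k h = Γ.arrow k h := by
  by_cases hh : Γ.Truncated h
  · rw [arrow_of_truncated hh, PathAlgebra.mul_zero']
  · rw [arrow_of_not hh]
    exact PathAlgebra.idem_mul_ofPath _

theorem arrow_mul_idem (h : H) :
    Γ.arrow k h * Γ.pathIdem k (Γ.edge (Γ.succ h)) = Γ.arrow k h := by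
  by_cases hh : Γ.Truncated h
  · rw [arrow_of_truncated hh, PathAlgebra.zero_mul']
  · rw [arrow_of_not hh]
    exact PathAlgebra.ofPath_mul_idem _

theorem truncated_iff (hm : ∀ v, Γ.mult v = 1) {h : H} : Γ.Truncated h ↔ Γ.succ h = h :=
  ⟨fun hh => hh.1, fun hh => ⟨hh, hm _⟩⟩

theorem truncated_succ_iff (hm : ∀ v, Γ.mult v = 1) {h : H} :
    Γ.Truncated (Γ.succ h) ↔ Γ.Truncated h := by
  rw [truncated_iff hm, truncated_iff hm, Γ.succ.injective.eq_iff]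

theorem truncated_iterate_iff (hm : ∀ v, Γ.mult v = 1) {h : H} (n : ℕ) :
    Γ.Truncated (Γ.succ^[n] h) ↔ Γ.Truncated h := by
  induction n with
  | zero => rfl
  | succ n ih => rw [Function.iterate_succ_apply', truncated_succ_iff hm, ih]

theorem valency_of_truncated {h : H} (hh : Γ.Truncated h) : Γ.valency h = 1 :=
  Function.minimalPeriod_eq_one_iff_isFixedPt.mpr hh.1

theorem word_eq_prod {A : Type*} [Ring A] {e : E → A} {a : H → A}
    (ha : ∀ h, a h * e (Γ.edge (Γ.succ h)) = a h) (h : H) (n : ℕ) :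
    Γ.word e a h (n + 1) = ((List.range (n + 1)).map fun m => a (Γ.succ^[m] h)).prod := by
  induction n generalizing h with
  | zero => simp [word, ha]
  | succ n ih =>
    rw [word, ih, List.range_succ_eq_map (n := n + 1), List.map_cons, List.prod_cons, List.map_map]
    rfl

variable [Fintype E]

theorem cycle_eq_word (h : H) : Γ.cycle k h
    = Γ.word (Γ.pathIdem k) (Γ.arrow k) h (Γ.valency h) := by
  obtain ⟨n, hn⟩ := Nat.exists_eq_succ_of_ne_zero (Γ.valency_pos h).ne'
  have h1 := word_eq_prod (Γ := Γ) (e := Γ.pathIdem k)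
    (a := Γ.arrow k) arrow_mul_idem h n
  rw [cycle]
  change ((List.range (Γ.valency h)).map _).prod = _
  rw [hn]
  exact h1.symm

theorem cyclePow_eq (hm : ∀ v, Γ.mult v = 1) (h : H) : Γ.cyclePow k h = Γ.cycle k h := by
  rw [cyclePow, hm, pow_one]

variable (Γ k) in
/-- The projection from the path algebra to the Brauer graph algebra. -/
def toAlgebra : PathAlgebra k Γ.QuiverVertex →ₐ[k] Γ.algebra k := BoundQuiverAlgebra.mk (Γ.relations k)

variable (Γ k) in
/-- The trivial paths in the Brauer graph algebra. -/
def algIdem (i : E) : Γ.algebra k := Γ.toAlgebra k (Γ.pathIdem k i)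

variable (Γ k) in
open Classical in
/-- The arrow of the half-edge `h` in the Brauer graph algebra. If there is no such arrow, then the
cycle at the other end of the edge takes its place. -/
def algArrow (h : H) : Γ.algebra k :=
  if Γ.Truncated h then Γ.toAlgebra k (Γ.cycle k (Γ.opp h)) else Γ.toAlgebra k (Γ.arrow k h)

theorem algArrow_of {h : H} (hh : Γ.Truncated h) :
    Γ.algArrow k h = Γ.toAlgebra k (Γ.cycle k (Γ.opp h)) := if_pos hh

theorem algArrow_of_not {h : H} (hh : ¬ Γ.Truncated h) :
    Γ.algArrow k h = Γ.toAlgebra k (Γ.arrow k h) := if_neg hh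

theorem pathIdem_mul_word (h : H) (n : ℕ) :
    Γ.pathIdem k (Γ.edge h) *
      Γ.word (Γ.pathIdem k) (Γ.arrow k) h n
      = Γ.word (Γ.pathIdem k) (Γ.arrow k) h n := by
  cases n with
  | zero => exact PathAlgebra.idem_mul_ofPath _
  | succ n => rw [word, ← mul_assoc, idem_mul_arrow]

theorem word_mul_pathIdem (h : H) (n : ℕ) :
    Γ.word (Γ.pathIdem k) (Γ.arrow k) h n *
      Γ.pathIdem k (Γ.edge (Γ.succ^[n] h))
      = Γ.word (Γ.pathIdem k) (Γ.arrow k) h n := by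
  induction n generalizing h with
  | zero => exact PathAlgebra.idem_mul_ofPath _
  | succ n ih => rw [word, mul_assoc, Function.iterate_succ_apply, ih]

theorem algIdem_mul_algArrow (h : H) :
    Γ.algIdem k (Γ.edge h) * Γ.algArrow k h = Γ.algArrow k h := by
  by_cases hh : Γ.Truncated h
  · rw [algArrow_of hh, algIdem, ← map_mul, cycle_eq_word, ← edge_opp h, pathIdem_mul_word]
  · rw [algArrow_of_not hh, algIdem, ← map_mul, idem_mul_arrow]

theorem algArrow_mul_algIdem (h : H) :
    Γ.algArrow k h * Γ.algIdem k (Γ.edge (Γ.succ h)) = Γ.algArrow k h := by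
  by_cases hh : Γ.Truncated h
  · have h1 := word_mul_pathIdem (Γ := Γ) (k := k) (Γ.opp h) (Γ.valency (Γ.opp h))
    rw [Γ.iterate_valency, edge_opp] at h1
    rw [algArrow_of hh, algIdem, ← map_mul, cycle_eq_word, hh.1, h1]
  · rw [algArrow_of_not hh, algIdem, ← map_mul, arrow_mul_idem]

theorem algIdem_mul_self (i : E) : Γ.algIdem k i * Γ.algIdem k i = Γ.algIdem k i := by
  rw [algIdem, ← map_mul]
  exact congrArg _ (PathAlgebra.idem_mul_ofPath _)

theorem algIdem_mul_of_ne {i j : E} (h : i ≠ j) : Γ.algIdem k i * Γ.algIdem k j = 0 := by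
  rw [algIdem, algIdem, ← map_mul]
  exact (congrArg _ (PathAlgebra.idem_mul_idem_of_ne (V := Γ.QuiverVertex) h)).trans (map_zero _)

/-- In the algebra, `cycle` is the word that runs once around a vertex. -/
theorem toAlgebra_cycle (hm : ∀ v, Γ.mult v = 1) {h : H} (hh : ¬ Γ.Truncated h) :
    Γ.toAlgebra k (Γ.cycle k h) = Γ.word (Γ.algIdem k) (Γ.algArrow k) h (Γ.valency h) := by
  rw [cycle_eq_word]
  generalize Γ.valency h = n
  induction n generalizing h with
  | zero => rfl
  | succ n ih =>
    rw [word, word, map_mul, ih (fun h' => hh ((truncated_succ_iff hm).mp h')), algArrow_of_not hh]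

theorem toAlgebra_relation {x : PathAlgebra k Γ.QuiverVertex} (hx : x ∈ Γ.relations k) :
    Γ.toAlgebra k x = 0 := BoundQuiverAlgebra.mk_eq_zero hx

theorem alg_word_valency_opp (hm : ∀ v, Γ.mult v = 1)
    (ht : ∀ h, Γ.Truncated h → ¬ Γ.Truncated (Γ.opp h)) (h : H) :
    Γ.word (Γ.algIdem k) (Γ.algArrow k) (Γ.opp h) (Γ.valency (Γ.opp h))
      = Γ.word (Γ.algIdem k) (Γ.algArrow k) h (Γ.valency h) := by
  have key : ∀ h, Γ.Truncated h →
      Γ.word (Γ.algIdem k) (Γ.algArrow k) (Γ.opp h) (Γ.valency (Γ.opp h))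
        = Γ.word (Γ.algIdem k) (Γ.algArrow k) h (Γ.valency h) := by
    intro h hh
    rw [valency_of_truncated hh, word, word, algArrow_mul_algIdem, algArrow_of hh,
      toAlgebra_cycle hm (ht h hh)]
  by_cases hh : Γ.Truncated h
  · exact key h hh
  by_cases hh' : Γ.Truncated (Γ.opp h)
  · have h1 := key _ hh'
    rw [Γ.opp_opp] at h1
    exact h1.symm
  · rw [← toAlgebra_cycle hm hh, ← toAlgebra_cycle hm hh', eq_comm, ← sub_eq_zero, ← map_sub]
    refine toAlgebra_relation (Or.inl (Or.inl ⟨h, hh, hh', ?_⟩))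
    rw [cyclePow_eq hm, cyclePow_eq hm]

theorem algArrow_mul_of_not {h : H} (hh : ¬ Γ.Truncated h)
    (hh' : ¬ Γ.Truncated (Γ.opp (Γ.succ h))) :
    Γ.algArrow k h * Γ.algArrow k (Γ.opp (Γ.succ h)) = 0 := by
  rw [algArrow_of_not hh, algArrow_of_not hh', ← map_mul]
  exact toAlgebra_relation (Or.inr ⟨h, hh, hh', rfl⟩)

theorem alg_word_succ {h : H} {n : ℕ} :
    Γ.word (Γ.algIdem k) (Γ.algArrow k) h (n + 1)
      = Γ.word (Γ.algIdem k) (Γ.algArrow k) h n * Γ.algArrow k (Γ.succ^[n] h) := by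
  induction n generalizing h with
  | zero =>
    rw [word, word, word, algArrow_mul_algIdem, Function.iterate_zero_apply, algIdem_mul_algArrow]
  | succ n ih => rw [word, ih, word, mul_assoc, Function.iterate_succ_apply]

theorem alg_cycle_mul (hm : ∀ v, Γ.mult v = 1)
    (ht : ∀ h, Γ.Truncated h → ¬ Γ.Truncated (Γ.opp h)) {h : H} (hh : ¬ Γ.Truncated h) :
    Γ.word (Γ.algIdem k) (Γ.algArrow k) h (Γ.valency h) * Γ.algArrow k h = 0 := by
  by_cases hh' : Γ.Truncated (Γ.opp h)
  · rw [← toAlgebra_cycle hm hh, algArrow_of_not hh, ← map_mul, ← cyclePow_eq hm]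
    exact toAlgebra_relation (Or.inl (Or.inr ⟨h, hh, hh', rfl⟩))
  · obtain ⟨n, hn⟩ := Nat.exists_eq_succ_of_ne_zero (Γ.valency_pos (Γ.opp h)).ne'
    have h1 : Γ.succ (Γ.succ^[n] (Γ.opp h)) = Γ.opp h := by
      rw [← Function.iterate_succ_apply' Γ.succ, ← hn, Γ.iterate_valency]
    rw [← alg_word_valency_opp hm ht, hn, Nat.succ_eq_add_one, alg_word_succ, mul_assoc]
    have h2 := algArrow_mul_of_not (k := k) (h := Γ.succ^[n] (Γ.opp h))
      (by rwa [truncated_iterate_iff hm]) (by rwa [h1, Γ.opp_opp])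
    rw [h1, Γ.opp_opp] at h2
    rw [h2, mul_zero]

theorem isArrowSystem_alg (hm : ∀ v, Γ.mult v = 1)
    (ht : ∀ h, Γ.Truncated h → ¬ Γ.Truncated (Γ.opp h)) :
    Γ.IsArrowSystem (Γ.algIdem k) (Γ.algArrow k) where
  idem_mul_idem i := algIdem_mul_self i
  idem_mul_idem_of_ne _ _ := algIdem_mul_of_ne
  sum_idem := (map_sum (Γ.toAlgebra k) _ _).symm.trans (map_one _)
  idem_mul := algIdem_mul_algArrow
  mul_idem := algArrow_mul_algIdem
  mul_eq_zero h h' hne := by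
    by_cases he : Γ.edge (Γ.succ h) = Γ.edge h'
    swap
    · rw [← algArrow_mul_algIdem, ← algIdem_mul_algArrow h', mul_assoc, ← mul_assoc (Γ.algIdem k _),
        algIdem_mul_of_ne he, zero_mul, mul_zero]
    obtain rfl | rfl := (Γ.edge_eq_iff _ _).mp he
    · exact absurd rfl hne
    by_cases hh : Γ.Truncated h
    · have h1 : ¬ Γ.Truncated (Γ.opp h) := ht h hh
      rw [algArrow_of hh, toAlgebra_cycle hm h1, hh.1, alg_cycle_mul hm ht h1]
    · by_cases hh' : Γ.Truncated (Γ.opp (Γ.succ h))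
      · have h1 := alg_word_succ (Γ := Γ) (k := k) (h := h) (n := Γ.valency h)
        rw [word, Γ.iterate_valency, alg_cycle_mul hm ht hh, ← Γ.valency_succ] at h1
        rw [algArrow_of hh', Γ.opp_opp, toAlgebra_cycle hm (by rwa [truncated_succ_iff hm]), h1]
      · exact algArrow_mul_of_not hh hh'

theorem alg_eq_top (U : Submodule k (Γ.algebra k)) (h1 : 1 ∈ U)
    (he : ∀ i, ∀ u ∈ U, Γ.algIdem k i * u ∈ U) (ha : ∀ h, ∀ u ∈ U, Γ.algArrow k h * u ∈ U) :
    U = ⊤ := by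
  refine BoundQuiverAlgebra.eq_top_of_mul_mem U h1 he ?_
  rintro _ _ ⟨h, hh, rfl, rfl⟩ u hu
  have h2 := ha h u hu
  rw [algArrow_of_not hh, arrow_of_not hh] at h2
  exact h2

namespace IsCutAlgebra

variable {L : H → Prop} {A : Type*} [Ring A] [Algebra k A] {e : E → A}
    {a : H → A} {ρ : A →ₐ[k] Module.End k (E ⊕ H × ℕ → k)} (hA : Γ.IsCutAlgebra L e a ρ)

variable (L a ρ) in
/-- The image of an arrow in the trivial extension. -/
def homImage {i j : Γ.QuiverVertex} (α : i ⟶ j) : TrivialExtension k A := extArrow Γ L a ρ α.1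

include hA in
theorem homImage_mul_idem {i j : Γ.QuiverVertex} (α : i ⟶ j) :
    homImage L a ρ α * extIdem k e j = homImage L a ρ α := by
  obtain ⟨h, _, rfl, rfl⟩ := α
  exact hA.isArrowSystem_ext.mul_idem h

/-- The map from the path algebra of a Brauer graph to the trivial extension. -/
def pathHom : PathAlgebra k Γ.QuiverVertex →ₐ[k] TrivialExtension k A :=
  PathAlgebra.lift (V := Γ.QuiverVertex) (extIdem k e) (homImage L a ρ)
    hA.isArrowSystem_ext.idem_mul_idem hA.isArrowSystem_ext.idem_mul_idem_of_ne
    hA.isArrowSystem_ext.sum_idem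
    hA.homImage_mul_idem

theorem pathHom_idem (i : E) : hA.pathHom (Γ.pathIdem k i) = extIdem k e i :=
  PathAlgebra.lift_idem (V := Γ.QuiverVertex) (e := extIdem k e) (x := homImage L a ρ) _ _ _
    hA.homImage_mul_idem i

theorem pathHom_arrow {h : H} (hh : ¬ Γ.Truncated h) :
    hA.pathHom (Γ.arrow k h) = extArrow Γ L a ρ h := by
  rw [arrow_of_not hh]
  exact PathAlgebra.lift_ofArrow (V := Γ.QuiverVertex) (e := extIdem k e) (x := homImage L a ρ)
    _ _ _ hA.homImage_mul_idem (hom hh) (hA.isArrowSystem_ext.idem_mul h)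

theorem pathHom_cycle (hm : ∀ v, Γ.mult v = 1) {h : H} (hh : ¬ Γ.Truncated h) :
    hA.pathHom (Γ.cycle k h)
      = Γ.word (extIdem k e) (extArrow Γ L a ρ) h (Γ.valency h) := by
  rw [cycle_eq_word]
  generalize Γ.valency h = n
  induction n generalizing h with
  | zero => exact hA.pathHom_idem _
  | succ n ih =>
    rw [word, word, map_mul, ih (fun h' => hh ((truncated_succ_iff hm).mp h')),
      hA.pathHom_arrow hh]

theorem pathHom_relation (hm : ∀ v, Γ.mult v = 1) {x : PathAlgebra k Γ.QuiverVertex}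
    (hx : x ∈ Γ.relations k) : hA.pathHom x = 0 := by
  obtain (⟨h, hh, hh', rfl⟩ | ⟨h, hh, hh', rfl⟩) | ⟨h, hh, hh', rfl⟩ := hx
  · rw [cyclePow_eq hm, cyclePow_eq hm, map_sub, hA.pathHom_cycle hm hh, hA.pathHom_cycle hm hh',
      hA.ext_word_valency_opp, sub_self]
  · rw [cyclePow_eq hm, map_mul, hA.pathHom_cycle hm hh, hA.pathHom_arrow hh,
      hA.isArrowSystem_ext.word_valency_mul hA.ext_word_valency_opp]
  · rw [map_mul, hA.pathHom_arrow hh, hA.pathHom_arrow hh',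
      hA.isArrowSystem_ext.mul_eq_zero _ _ (Γ.opp_ne _)]

include hA in
/-- The trivial extension is isomorphic to the Brauer graph algebra. -/
theorem nonempty_algEquiv (hm : ∀ v, Γ.mult v = 1)
    (ht : ∀ h, Γ.Truncated h → ¬ Γ.Truncated (Γ.opp h)) :
    Nonempty (TrivialExtension k A ≃ₐ[k] Γ.algebra k) := by
  let φ : Γ.algebra k →ₐ[k] TrivialExtension k A :=
    BoundQuiverAlgebra.lift hA.pathHom fun _ => hA.pathHom_relation hm
  have hφ : ∀ x, φ (Γ.toAlgebra k x) = hA.pathHom x := fun _ => rfl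
  have hbij : Function.Bijective φ := by
    refine hA.bijective_of_map (isArrowSystem_alg hm ht) (alg_word_valency_opp hm ht) alg_eq_top φ
      (fun i => hA.pathHom_idem i) fun h => ?_
    by_cases hh : Γ.Truncated h
    · rw [algArrow_of hh, hφ, hA.pathHom_cycle hm (ht h hh), hA.ext_word_valency_opp,
        valency_of_truncated hh, hA.isArrowSystem_ext.word_one]
    · rw [algArrow_of_not hh, hφ, hA.pathHom_arrow hh]
  exact ⟨(AlgEquiv.ofBijective φ hbij).symm⟩

end IsCutAlgebra

/-- If both ends of an edge have valency one, then there is no other edge. -/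
theorem not_truncated_opp (hE : 2 ≤ Fintype.card E) {h : H} (hh : Γ.Truncated h) :
    ¬ Γ.Truncated (Γ.opp h) := by
  intro hh'
  have hfix : ∀ g g', Γ.succ g = g → Γ.vert g = Γ.vert g' → g' = g := by
    intro g g' hg hv
    obtain ⟨n, hn⟩ := (Γ.vert_eq_iff _ _).mp hv
    rw [← hn]
    exact Equiv.Perm.zpow_apply_eq_self_of_apply_eq_self hg n
  have hedge : ∀ g g', Γ.vert g = Γ.vert g' ∨ Γ.edge g = Γ.edge g' →
      Γ.edge g = Γ.edge h → Γ.edge g' = Γ.edge h := by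
    rintro g g' (hv | he) hg
    · obtain rfl | rfl := (Γ.edge_eq_iff h g).mp hg.symm
      · rw [hfix _ _ hh.1 hv]
      · rw [hfix _ _ hh'.1 hv, edge_opp]
    · rw [← he, hg]
  have hall : ∀ g, Γ.edge g = Γ.edge h := by
    intro g
    have hiff : ∀ x y, Relation.EqvGen (fun a b => Γ.vert a = Γ.vert b ∨ Γ.edge a = Γ.edge b) x y →
        (Γ.edge x = Γ.edge h ↔ Γ.edge y = Γ.edge h) := by
      intro x y hxy
      induction hxy with
      | rel x y hxy =>
        exact ⟨hedge x y hxy, hedge y x (hxy.imp Eq.symm Eq.symm)⟩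
      | refl => rfl
      | symm x y _ ih => exact ih.symm
      | trans x y z _ _ ih ih' => exact ih.trans ih'
    exact (hiff h g (Γ.connected h g)).mp rfl
  obtain ⟨i, j, hij⟩ := Fintype.exists_pair_of_one_lt_card hE
  obtain ⟨g, rfl⟩ := Γ.edge_surjective i
  obtain ⟨g', rfl⟩ := Γ.edge_surjective j
  exact hij ((hall g).trans (hall g').symm)

end BrauerGraph

namespace PolygonGluing

variable (G : PolygonGluing)

/-! ### The last ends before the boundary -/

/-- The end `h` is the last one, in clockwise order, before the boundary. -/
def IsLast (h : G.ArcEnd) : Prop := G.IsBoundary (G.cw h.1)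

variable {G}

theorem succ_of_not_isLast {h : G.ArcEnd} (hh : ¬ G.IsLast h) : G.succ h = ⟨G.cw h.1, hh⟩ :=
  G.succFun_of_not hh

theorem iterate_succ_of_isLast {h : G.ArcEnd} (hh : G.IsLast h) {j : ℕ} (hj : j ≤ G.fanIndex h.1) :
    (G.succ^[j + 1] h).1 = (G.cw⁻¹ ^ (G.fanIndex h.1 - j)) h.1 := by
  induction j with
  | zero =>
    change (G.succFun h).1 = _
    rw [G.succFun_of hh]
    rfl
  | succ j ih =>
    have h1 := ih (by omega)
    have h2 : G.cw (G.succ^[j + 1] h).1 = (G.cw⁻¹ ^ (G.fanIndex h.1 - (j + 1))) h.1 := by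
      have h3 : G.fanIndex h.1 - j = G.fanIndex h.1 - (j + 1) + 1 := by omega
      rw [h1, h3, pow_succ', Equiv.Perm.mul_apply, G.cw_cw_inv]
    have h4 : ¬ G.IsLast (G.succ^[j + 1] h) := by
      rw [IsLast, h2]
      exact G.not_isBoundary_of_le h.2 (by omega)
    rw [Function.iterate_succ_apply', succ_of_not_isLast h4]
    exact h2

theorem iterate_succ_eq_of_isLast {h : G.ArcEnd} {n : ℕ} (hh : G.IsLast h)
    (hn : G.IsLast (G.succ^[n] h)) : G.succ^[n] h = h := by
  have hper : Function.IsPeriodicPt G.succ (G.fanIndex h.1 + 1) h := by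
    refine Subtype.ext ?_
    rw [iterate_succ_of_isLast hh le_rfl, Nat.sub_self, pow_zero, Equiv.Perm.one_apply]
  rw [← hper.iterate_mod_apply n] at hn ⊢
  have hlt := Nat.mod_lt n (Nat.succ_pos (G.fanIndex h.1))
  generalize n % (G.fanIndex h.1 + 1) = m at *
  cases m with
  | zero => rfl
  | succ j =>
    exfalso
    have h1 : G.fanIndex h.1 - j = G.fanIndex h.1 - (j + 1) + 1 := by omega
    rw [IsLast, iterate_succ_of_isLast hh (by omega), h1, pow_succ', Equiv.Perm.mul_apply,
      G.cw_cw_inv] at hn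
    exact G.not_isBoundary_of_le h.2 (by omega) hn

/-- An end at a marked point on the boundary is in the orbit of a last end. -/
theorem exists_isLast {h : G.ArcEnd} (hb : G.vertex h.1 ∈ G.boundary) :
    ∃ n, G.IsLast (G.succ^[n] h) := by
  have horbit : ∀ g : G.ArcEnd, G.fanClass h.1 = some (Quotient.mk _ g) →
      ∃ n, G.succ^[n] h = g := by
    intro g hg
    have hh : ¬ G.IsBoundary h.1 := h.2
    rw [fanClass, dif_neg hh, Option.some.injEq] at hg
    obtain ⟨n, hn⟩ := (Quotient.exact hg : G.succ.SameCycle h g).exists_nat_pow_eq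
    exact ⟨n, by rw [← hn, ← Equiv.Perm.iterate_eq_pow]⟩
  obtain ⟨d, t, hd, ht⟩ := hb
  have h1 : G.vertexClass ⟨h.1, (1, 0)⟩ = G.vertexClass ⟨d, (1, t)⟩ :=
    congrArg (Quot.lift G.vertexClass fun _ _ => G.vertexClass_eq) ht
  have h2 : G.vertexClass ⟨h.1, (1, 0)⟩ = some (Quot.mk _ h.1) := if_pos ⟨rfl, rfl⟩
  rw [h2] at h1
  by_cases ht0 : t = 0
  · subst ht0
    rw [vertexClass, if_pos ⟨rfl, rfl⟩, Option.some.injEq] at h1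
    have h3 := congrArg (Quot.lift G.fanClass fun _ _ => G.fanClass_eq_of_turn) h1
    change G.fanClass h.1 = G.fanClass d at h3
    by_cases hd' : G.IsBoundary (G.cw⁻¹ d)
    · have hh : ¬ G.IsBoundary h.1 := h.2
      simp only [fanClass, hh, hd, hd', dite_false, dite_true, reduceCtorEq] at h3
    · obtain ⟨n, hn⟩ := horbit ⟨G.cw⁻¹ d, hd'⟩ (h3.trans (by simp only [fanClass, hd, hd', dite_true, dite_false]))
      refine ⟨n, ?_⟩
      rw [hn, IsLast, G.cw_cw_inv]
      exact hd
  by_cases ht1 : t = 1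
  swap
  · simp [vertexClass, ht0, ht1] at h1
  subst ht1
  rw [vertexClass, if_neg (by simp), if_pos ⟨rfl, rfl⟩, Option.some.injEq] at h1
  have h3 := congrArg (Quot.lift G.fanClass fun _ _ => G.fanClass_eq_of_turn) h1
  change G.fanClass h.1 = G.fanClass (G.next d) at h3
  have hcw : G.cw d = G.next d := by
    rw [cw_apply]
    exact congrArg G.next hd
  have hcw' : G.cw⁻¹ (G.next d) = d := by rw [← hcw, G.cw_inv_cw]
  by_cases hd' : G.IsBoundary (G.next d)
  · have hh : ¬ G.IsBoundary h.1 := h.2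
    simp [fanClass, hh, hd, hd', hcw'] at h3
  · let g : G.ArcEnd := ⟨G.next d, hd'⟩
    have hg : G.fanClass h.1 = some (Quotient.mk _ (G.succ⁻¹ g)) := by
      rw [h3, fanClass, dif_neg hd']
      refine congrArg some (Quotient.sound (s := Equiv.Perm.SameCycle.setoid G.succ) ?_)
      exact ⟨-1, by rw [zpow_neg_one]⟩
    obtain ⟨n, hn⟩ := horbit _ hg
    refine ⟨n, ?_⟩
    rw [hn]
    by_contra hlast
    have h4 := succ_of_not_isLast hlast
    have h5 : G.succ (G.succ⁻¹ g) = g := G.succ.apply_symm_apply g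
    rw [h5] at h4
    have h6 : G.cw (G.succ⁻¹ g).1 = G.cw d := (congrArg Subtype.val h4).symm.trans hcw.symm
    have h7 := (G.succ⁻¹ g).2
    rw [G.cw.injective h6] at h7
    exact h7 hd

/-! ### The algebra of a decomposition as an algebra of arrows around vertices -/

variable (G) in
/-- `Γ` is the graph of the arcs, with the clockwise cyclic orderings. -/
structure IsArcGraph {V : Type*} (Γ : BrauerGraph V G.Arc G.ArcEnd) : Prop where
  edge : ∀ h, Γ.edge h = G.arc h
  succ : ∀ h, Γ.succ h = G.succ h

theorem IsArcGraph.isCutAt {V : Type*} {Γ : BrauerGraph V G.Arc G.ArcEnd} (hΓ : G.IsArcGraph Γ)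
    {S : Type*} [TopologicalSpace S] {M : Set S} (D : G.Decomposition S M) :
    Γ.IsCutAt G.IsLast := by
  have hs : (Γ.succ : G.ArcEnd → G.ArcEnd) = G.succ := funext hΓ.succ
  refine ⟨fun h => ?_, fun h n => ?_⟩
  · rw [hs]
    refine exists_isLast ?_
    obtain ⟨x, hx, hx'⟩ := D.marked_subset (D.marked.subset (Set.mem_range_self h.1))
    rwa [← D.homeo.injective hx']
  · rw [hs]
    exact iterate_succ_eq_of_isLast

section Algebra

variable (k : Type*) [Field k]

variable (G) in
/-- The trivial path of an arc in the algebra of a decomposition. -/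
def arcIdem (i : G.Arc) : G.algebra k :=
  BoundQuiverAlgebra.mk (G.cornerRelations k) (PathAlgebra.idem k (V := G.QuiverVertex) i)

open Classical in
variable (G) in
/-- The arrow from an end to the next one in clockwise order, if it is not the last one. -/
def endArrow (h : G.ArcEnd) : G.algebra k :=
  if hb : G.IsLast h then 0
  else BoundQuiverAlgebra.mk (G.cornerRelations k)
    (G.cornerArrow k (G.glue h.1) (G.oppEnd h).2 hb)

variable {k}

theorem endArrow_of {h : G.ArcEnd} (hb : G.IsLast h) : G.endArrow k h = 0 := dif_pos hb

theorem endArrow_of_not {h : G.ArcEnd} (hb : ¬ G.IsLast h) :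
    G.endArrow k h = BoundQuiverAlgebra.mk (G.cornerRelations k)
      (G.cornerArrow k (G.glue h.1) (G.oppEnd h).2 hb) := dif_neg hb

theorem arc_oppEnd (h : G.ArcEnd) : G.arc (G.oppEnd h) = G.arc h :=
  ((G.arc_eq_iff h _).mpr (Or.inr rfl)).symm

theorem oppEnd_oppEnd (h : G.ArcEnd) : G.oppEnd (G.oppEnd h) = h := Subtype.ext (G.glue_glue h.1)

/-- The end around which an arrow turns. -/
def homEnd {i j : G.QuiverVertex} (α : i ⟶ j) : G.ArcEnd := G.oppEnd ⟨α.1, α.2.choose⟩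

theorem not_isLast_homEnd {i j : G.QuiverVertex} (α : i ⟶ j) : ¬ G.IsLast (homEnd α) := by
  obtain ⟨d, hd, hd', _, _⟩ := α
  change ¬ G.IsBoundary (G.next (G.glue (G.glue d)))
  rwa [G.glue_glue]

theorem arc_homEnd {i j : G.QuiverVertex} (α : i ⟶ j) : G.arc (homEnd α) = i := by
  obtain ⟨d, hd, hd', rfl, rfl⟩ := α
  exact arc_oppEnd ⟨d, hd⟩

theorem arc_succ_homEnd {i j : G.QuiverVertex} (α : i ⟶ j) : G.arc (G.succ (homEnd α)) = j := by
  rw [succ_of_not_isLast (not_isLast_homEnd α)]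
  obtain ⟨d, hd, hd', rfl, rfl⟩ := α
  refine congrArg G.arc (Subtype.ext ?_)
  change G.next (G.glue (G.glue d)) = G.next d
  rw [G.glue_glue]

theorem ofArrow_eq_endArrow {i j : G.QuiverVertex} (α : i ⟶ j) :
    BoundQuiverAlgebra.mk (G.cornerRelations k) (PathAlgebra.ofArrow k α)
      = G.endArrow k (homEnd α) := by
  rw [endArrow_of_not (not_isLast_homEnd α)]
  obtain ⟨d, hd, hd', rfl, rfl⟩ := α
  have key : ∀ d' (h : ¬ G.IsBoundary d') (h' : ¬ G.IsBoundary (G.next d')), d' = d →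
      G.cornerArrow k d hd hd' = G.cornerArrow k d' h h' := by
    rintro _ h h' rfl
    rfl
  exact congrArg _ (key _ _ _ (G.glue_glue d))

variable {V : Type*} {Γ : BrauerGraph V G.Arc G.ArcEnd} (hΓ : G.IsArcGraph Γ)

section
include hΓ

theorem IsArcGraph.isArrowSystem : Γ.IsArrowSystem (G.arcIdem k) (G.endArrow k) := by
  have hne : ∀ i j : G.Arc, i ≠ j → G.arcIdem k i * G.arcIdem k j = 0 := by
    intro i j hij
    rw [arcIdem, arcIdem, ← map_mul]
    exact (congrArg _ (PathAlgebra.idem_mul_idem_of_ne (V := G.QuiverVertex) hij)).trans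
      (map_zero _)
  have hl : ∀ h, G.arcIdem k (G.arc h) * G.endArrow k h = G.endArrow k h := by
    intro h
    by_cases hb : G.IsLast h
    · rw [endArrow_of hb, mul_zero]
    · rw [endArrow_of_not hb, arcIdem, ← map_mul, ← arc_oppEnd h]
      exact congrArg _ (PathAlgebra.idem_mul_ofPath _)
  have hr : ∀ h, G.endArrow k h * G.arcIdem k (G.arc (G.succ h)) = G.endArrow k h := by
    intro h
    by_cases hb : G.IsLast h
    · rw [endArrow_of hb, zero_mul]
    · rw [endArrow_of_not hb, arcIdem, ← map_mul, succ_of_not_isLast hb]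
      exact congrArg _ (PathAlgebra.ofPath_mul_idem _)
  refine ⟨fun i => ?_, hne, (map_sum (BoundQuiverAlgebra.mk _) _ _).symm.trans (map_one _),
    fun h => ?_, fun h => ?_, fun h h' hh => ?_⟩
  · rw [arcIdem, ← map_mul]
    exact congrArg _ (PathAlgebra.idem_mul_ofPath _)
  · rw [hΓ.edge, hl]
  · rw [hΓ.edge, hΓ.succ, hr]
  · rw [hΓ.succ] at hh
    by_cases he : G.arc (G.succ h) = G.arc h'
    swap
    · rw [← hr h, ← hl h', mul_assoc, ← mul_assoc (G.arcIdem k _), hne _ _ he, zero_mul, mul_zero]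
    obtain rfl | rfl := (G.arc_eq_iff _ _).mp he
    · exact absurd rfl hh
    by_cases hb : G.IsLast h
    · rw [endArrow_of hb, zero_mul]
    by_cases hb' : G.IsLast (G.oppEnd (G.succ h))
    · rw [endArrow_of hb', mul_zero]
    have h1 : G.glue (G.oppEnd (G.succ h)).1 = G.next (G.glue h.1) := by
      rw [succ_of_not_isLast hb]
      exact G.glue_glue _
    rw [endArrow_of_not hb, endArrow_of_not hb', ← map_mul]
    have key : ∀ d (hd : ¬ G.IsBoundary d) (hd' : ¬ G.IsBoundary (G.next d)),
        d = G.next (G.glue h.1) → BoundQuiverAlgebra.mk (G.cornerRelations k)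
          (G.cornerArrow k (G.glue h.1) (G.oppEnd h).2 hb * G.cornerArrow k d hd hd') = 0 := by
      rintro _ hd hd' rfl
      exact BoundQuiverAlgebra.mk_eq_zero ⟨_, _, _, hd', rfl⟩
    exact key _ _ _ h1

theorem IsArcGraph.arrowOp_mul_idemOp {i j : G.QuiverVertex} (α : i ⟶ j) :
    Γ.arrowOp k (homEnd α) * Γ.idemOp k j = Γ.arrowOp k (homEnd α) := by
  have h1 := (Γ.isArrowSystem_op k).mul_idem (homEnd α)
  rwa [hΓ.edge, hΓ.succ, arc_succ_homEnd] at h1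

theorem IsArcGraph.idemOp_mul_arrowOp {i j : G.QuiverVertex} (α : i ⟶ j) :
    Γ.idemOp k i * Γ.arrowOp k (homEnd α) = Γ.arrowOp k (homEnd α) := by
  have h1 := (Γ.isArrowSystem_op k).idem_mul (homEnd α)
  rwa [hΓ.edge, arc_homEnd] at h1

end

/-- The action of the path algebra of a decomposition on formal paths. -/
def IsArcGraph.pathAction :
    PathAlgebra k G.QuiverVertex →ₐ[k] Module.End k (G.Arc ⊕ G.ArcEnd × ℕ → k) :=
  PathAlgebra.lift (V := G.QuiverVertex) (Γ.idemOp k) (fun α => Γ.arrowOp k (homEnd α))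
    (Γ.isArrowSystem_op k).idem_mul_idem (Γ.isArrowSystem_op k).idem_mul_idem_of_ne
    (Γ.isArrowSystem_op k).sum_idem hΓ.arrowOp_mul_idemOp

theorem IsArcGraph.pathAction_idem (i : G.QuiverVertex) :
    hΓ.pathAction (PathAlgebra.idem k i) = Γ.idemOp k i :=
  PathAlgebra.lift_idem (V := G.QuiverVertex) (e := Γ.idemOp k)
    (x := fun α => Γ.arrowOp k (homEnd α)) _ _ _ hΓ.arrowOp_mul_idemOp i

theorem IsArcGraph.pathAction_ofArrow {i j : G.QuiverVertex} (α : i ⟶ j) :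
    hΓ.pathAction (PathAlgebra.ofArrow k α) = Γ.arrowOp k (homEnd α) :=
  PathAlgebra.lift_ofArrow (V := G.QuiverVertex) (e := Γ.idemOp k)
    (x := fun α => Γ.arrowOp k (homEnd α)) _ _ _ hΓ.arrowOp_mul_idemOp α
    (hΓ.idemOp_mul_arrowOp α)

theorem IsArcGraph.pathAction_cornerArrow (d : G.Side) (h : ¬ G.IsBoundary d)
    (h' : ¬ G.IsBoundary (G.next d)) :
    hΓ.pathAction (G.cornerArrow k d h h') = Γ.arrowOp k (G.oppEnd ⟨d, h⟩) :=
  hΓ.pathAction_ofArrow _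

theorem IsArcGraph.pathAction_relation {x : PathAlgebra k G.QuiverVertex}
    (hx : x ∈ G.cornerRelations k) : hΓ.pathAction x = 0 := by
  obtain ⟨d, h, h', h'', rfl⟩ := hx
  rw [map_mul, hΓ.pathAction_cornerArrow, hΓ.pathAction_cornerArrow]
  refine (Γ.isArrowSystem_op k).mul_eq_zero _ _ ?_
  have h1 : ¬ G.IsLast (G.oppEnd ⟨d, h⟩) := by
    change ¬ G.IsBoundary (G.next (G.glue (G.glue d)))
    rwa [G.glue_glue]
  rw [hΓ.succ, succ_of_not_isLast h1]
  intro he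
  have he' : G.glue (G.next d) = G.next (G.glue (G.glue d)) := congrArg Subtype.val he
  rw [G.glue_glue] at he'
  exact h' he'

/-- The action of the algebra of a decomposition on formal paths. -/
def IsArcGraph.action : G.algebra k →ₐ[k] Module.End k (G.Arc ⊕ G.ArcEnd × ℕ → k) :=
  BoundQuiverAlgebra.lift hΓ.pathAction fun _ => hΓ.pathAction_relation

theorem IsArcGraph.isCutAlgebra {S : Type*} [TopologicalSpace S] {M : Set S}
    (D : G.Decomposition S M) :
    Γ.IsCutAlgebra G.IsLast (G.arcIdem k) (G.endArrow k) hΓ.action where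
  toIsArrowSystem := hΓ.isArrowSystem
  cut := hΓ.isCutAt D
  eq_zero _ := endArrow_of
  generate U h1 he ha := by
    refine BoundQuiverAlgebra.eq_top_of_mul_mem U h1 he ?_
    intro i j α u hu
    rw [ofArrow_eq_endArrow]
    exact ha _ u hu
  map_idem i := hΓ.pathAction_idem i
  map_arrow h hh := by
    rw [endArrow_of_not hh]
    refine (hΓ.pathAction_cornerArrow _ _ _).trans (congrArg _ ?_)
    exact oppEnd_oppEnd h

end Algebra

end PolygonGluing

end

theorem corollary1p6 {k : Type*} [Field k] [IsAlgClosed k]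
    {S : Type*} [TopologicalSpace S] [ConnectedSpace S] {M M' : Set S}
    (T : IdealTriangulation S M) (χ : T.Cut) (P : χ.PartialTriangulation M')
    (hP : 2 ≤ Nat.card χ.gluing.Arc) :
    Nonempty (TrivialExtension k (χ.surfaceAlgebra k) ≃ₐ[k] P.brauerGraph.algebra k) := by
  have hΓ : χ.gluing.IsArcGraph P.brauerGraph := ⟨fun _ => rfl, fun _ => rfl⟩
  refine (hΓ.isCutAlgebra P).nonempty_algEquiv (fun _ => rfl) fun h => ?_
  exact BrauerGraph.not_truncated_opp (by rwa [← Nat.card_eq_fintype_card])
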